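/- Let $a,b,c,d,q$ be indeterminates and $\mathbf i=\sqrt{-1}$. Write $(x;q)_n=\prod_{j=0}^{n-1}(1-xq^j)$. For $x=\cos\theta$, let $$p_n(x;a,b,c,d|q)=\frac{(ab;q)_n(ac;q)_n(ad;q)_n}{2^na^n(abcdq^{n-1};q)_n}\;{}_4\phi_3\!\left(\begin{matrix}q^{-n},\,abcdq^{n-1},\,ae^{\mathbf i\theta},\,ae^{-\mathbf i\theta}\\ ab,\,ac,\,ad\end{matrix};q,q\right)$$ be the monic Askey--Wilson polynomials, and let $$H_n(x|q)=\frac{e^{\mathbf i n\theta}}{2^n}\;{}_2\phi_0\!\left(\begin{matrix}q^{-n},\,0\\ -\end{matrix};q,q^ne^{-2\mathbf i\theta}\right)$$ be the monic continuous $q$-Hermite polynomials. Let $\sigma^{AW,H}_{n,k}(a,b,c,d;q)$ be the mixed moments of the Askey--Wilson polynomials relative to the continuous $q$-Hermite polynomials, that is, the coefficients defined by $$H_n(x|q)=\sum_{k=0}^n\sigma^{AW,H}_{n,k}(a,b,c,d;q)\,p_k(x;a,b,c,d|q),\qquad \sigma^{AW,H}_{n,k}=0\ \text{ for } k>n,$$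 and let $$\widetilde\sigma^{AW,H}_{n,k}(a,b,c,d;q)=\left(\frac{2}{\mathbf i}\right)^{n-k}\sigma^{AW,H}_{n,k}(\mathbf ia,\mathbf ib,\mathbf ic,\mathbf id;q).$$ Then the infinite matrix $\bigl(\widetilde\sigma^{AW,H}_{n,k}(a,b,c,d;q)\bigr)_{n,k=0}^\infty$ is totally positive in the following strong sense: for every $r\ge0$ and all $0\le n_1<\dots<n_r$ and $0\le k_1<\dots<k_r$, the minor $\det\bigl(\widetilde\sigma^{AW,H}_{n_i,k_j}(a,b,c,d;q)\bigr)_{i,j=1}^r$ is a formal power series in $a,b,c,d,q$ with nonnegative integer coefficients. -/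

import Mathlib

open scoped Polynomial

noncomputable section

namespace AskeyWilson

section Polynomials

variable {K : Type*} [Field K]

/-- The `q`-Pochhammer symbol `(x; q)_n = (1 - x) (1 - x q) ⋯ (1 - x q ^ (n - 1))`. -/
def qPoch (x q : K) (n : ℕ) : K := ∏ j ∈ Finset.range n, (1 - x * q ^ j)

/-- The terminating basic hypergeometric series `r φ s (as; bs; q, z)`, where one of the upper
parameters is `q ^ (-n)`, so that all terms with index larger than `n` vanish. -/
def qHyper (as bs : List K) (q z : K) (n : ℕ) : K :=
  ∑ k ∈ Finset.range (n + 1),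
    (as.map fun x => qPoch x q k).prod / (qPoch q q k * (bs.map fun x => qPoch x q k).prod) *
      ((-1) ^ k * q ^ k.choose 2) ^ (1 + (bs.length : ℤ) - (as.length : ℤ)) * z ^ k

/-- The polynomial `(a e^{iθ}; q)_k (a e^{-iθ}; q)_k` in `x = cos θ`. -/
def awFactor (a q : K) (k : ℕ) : K[X] :=
  ∏ j ∈ Finset.range k,
    (1 - Polynomial.C (2 * a * q ^ j) * Polynomial.X + Polynomial.C (a ^ 2 * q ^ (2 * j)))

/-- The monic Askey–Wilson polynomial `p_n(x; a, b, c, d | q)`. -/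
def askeyWilson (a b c d q : K) (n : ℕ) : K[X] :=
  Polynomial.C (qPoch (a * b) q n * qPoch (a * c) q n * qPoch (a * d) q n /
      ((2 * a) ^ n * qPoch (a * b * c * d * q ^ ((n : ℤ) - 1)) q n)) *
    ∑ k ∈ Finset.range (n + 1),
      Polynomial.C (qPoch (q ^ (-(n : ℤ))) q k * qPoch (a * b * c * d * q ^ ((n : ℤ) - 1)) q k /
          (qPoch q q k * (qPoch (a * b) q k * qPoch (a * c) q k * qPoch (a * d) q k)) * q ^ k) *
        awFactor a q k

/-- The monic continuous `q`-Hermite polynomial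
`H_n(x | q) = 2^{-n} ∑_k [n choose k]_q e^{i (n - 2 k) θ}`, where `x = cos θ`; by the symmetry
`k ↦ n - k` of the coefficients, `e^{i (n - 2 k) θ}` can be replaced with
`cos ((n - 2 k) θ) = T_{n - 2 k}(x)`. -/
def qHermite (q : K) (n : ℕ) : K[X] :=
  Polynomial.C ((2 ^ n)⁻¹) * ∑ k ∈ Finset.range (n + 1),
    Polynomial.C (qPoch q q n / (qPoch q q k * qPoch q q (n - k))) *
      Polynomial.Chebyshev.T K ((n : ℤ) - 2 * (k : ℤ))

/-- The Askey–Wilson polynomials have their standard hypergeometric expression, with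
`x = (z + z⁻¹) / 2` and `z = e^{iθ}`. -/
theorem eval_askeyWilson (h2 : (2 : K) ≠ 0) (a b c d q z : K) (hz : z ≠ 0) (n : ℕ) :
    (askeyWilson a b c d q n).eval ((z + z⁻¹) / 2) =
      qPoch (a * b) q n * qPoch (a * c) q n * qPoch (a * d) q n /
          ((2 * a) ^ n * qPoch (a * b * c * d * q ^ ((n : ℤ) - 1)) q n) *
        qHyper [q ^ (-(n : ℤ)), a * b * c * d * q ^ ((n : ℤ) - 1), a * z, a * z⁻¹]
          [a * b, a * c, a * d] q q n := by
  have hf : ∀ k, (awFactor a q k).eval ((z + z⁻¹) / 2) =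
      qPoch (a * z) q k * qPoch (a * z⁻¹) q k := by
    intro k
    simp only [awFactor, qPoch, Polynomial.eval_prod, ← Finset.prod_mul_distrib]
    refine Finset.prod_congr rfl fun j _ => ?_
    simp only [Polynomial.eval_add, Polynomial.eval_sub, Polynomial.eval_one,
      Polynomial.eval_mul, Polynomial.eval_C, Polynomial.eval_X]
    field_simp
    ring
  simp only [askeyWilson, qHyper, Polynomial.eval_mul, Polynomial.eval_C,
    Polynomial.eval_finsetSum, hf]
  congr 1
  refine Finset.sum_congr rfl fun k _ => ?_
  simp
  ring

theorem two_mul_eval_T (h2 : (2 : K) ≠ 0) (z : K) (hz : z ≠ 0) (m : ℤ) :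
    2 * (Polynomial.Chebyshev.T K m).eval ((z + z⁻¹) / 2) = z ^ m + z ^ (-m) := by
  induction m using Polynomial.Chebyshev.induct with
  | zero => simp; norm_num
  | one => simp; field_simp
  | add_two n ih1 ih2 =>
    rw [Polynomial.Chebyshev.T_add_two]
    simp only [Polynomial.eval_sub, Polynomial.eval_mul, Polynomial.eval_ofNat,
      Polynomial.eval_X]
    have e : 2 * (2 * ((z + z⁻¹) / 2) * Polynomial.eval ((z + z⁻¹) / 2)
          (Polynomial.Chebyshev.T K (n + 1)) -
          Polynomial.eval ((z + z⁻¹) / 2) (Polynomial.Chebyshev.T K n)) =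
        (z + z⁻¹) * (2 * Polynomial.eval ((z + z⁻¹) / 2) (Polynomial.Chebyshev.T K (n + 1))) -
          2 * Polynomial.eval ((z + z⁻¹) / 2) (Polynomial.Chebyshev.T K n) := by
      field_simp
    rw [e, ih1, ih2]
    simp only [neg_add, zpow_add₀ hz, zpow_neg, zpow_natCast, zpow_ofNat]
    field_simp
    ring
  | neg_add_one n ih1 ih2 =>
    rw [Polynomial.Chebyshev.T_sub_one]
    simp only [Polynomial.eval_sub, Polynomial.eval_mul, Polynomial.eval_ofNat,
      Polynomial.eval_X]
    have e : 2 * (2 * ((z + z⁻¹) / 2) * Polynomial.eval ((z + z⁻¹) / 2)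
          (Polynomial.Chebyshev.T K (-n)) -
          Polynomial.eval ((z + z⁻¹) / 2) (Polynomial.Chebyshev.T K (-n + 1))) =
        (z + z⁻¹) * (2 * Polynomial.eval ((z + z⁻¹) / 2) (Polynomial.Chebyshev.T K (-n))) -
          2 * Polynomial.eval ((z + z⁻¹) / 2) (Polynomial.Chebyshev.T K (-n + 1)) := by
      field_simp
    rw [e, ih1, ih2]
    simp only [neg_add, neg_neg, sub_eq_add_neg, zpow_add₀ hz, zpow_neg, zpow_one,
      zpow_natCast]
    field_simp
    ring

theorem qPoch_succ (x q : K) (n : ℕ) : qPoch x q (n + 1) = qPoch x q n * (1 - x * q ^ n) := by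
  simp [qPoch, Finset.prod_range_succ]

theorem qPoch_self_ne_zero {q : K} (hq : ∀ m : ℕ, q ^ (m + 1) ≠ 1) (n : ℕ) :
    qPoch q q n ≠ 0 := by
  refine Finset.prod_ne_zero_iff.2 fun j _ h => hq j ?_
  rw [pow_succ']
  exact (sub_eq_zero.1 h).symm

/-- `(q^{-n}; q)_k = [n choose k]_q (q; q)_k (-1)^k q^{(k choose 2) - n k}`. -/
theorem qPoch_neg {q : K} (hq0 : q ≠ 0) (n k : ℕ) (hk : k ≤ n) :
    qPoch (q ^ (-(n : ℤ))) q k * q ^ (n * k) * qPoch q q (n - k) =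
      qPoch q q n * ((-1) ^ k * q ^ k.choose 2) := by
  induction k with
  | zero => simp [qPoch]
  | succ k ih =>
    have ih' := ih (by omega)
    obtain ⟨m, rfl⟩ : ∃ m, n = k + 1 + m := ⟨n - (k + 1), by omega⟩
    have e1 : k + 1 + m - k = m + 1 := by omega
    have e2 : k + 1 + m - (k + 1) = m := by omega
    rw [e1, qPoch_succ] at ih'
    rw [e2, qPoch_succ]
    have e3 : (q ^ (-((k + 1 + m : ℕ) : ℤ)) * q ^ k) * q ^ (m + 1) = 1 := by
      rw [zpow_neg, zpow_natCast]
      field_simp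
      ring
    have e4 : (1 - q ^ (-((k + 1 + m : ℕ) : ℤ)) * q ^ k) * q ^ (k + 1 + m) =
        -(q ^ k * (1 - q * q ^ m)) := by
      have e5 : q ^ (k + 1 + m) = q ^ (m + 1) * q ^ k := by ring
      rw [e5, sub_mul, ← mul_assoc (_ * _) (q ^ (m + 1)) (q ^ k), e3]
      ring
    have e6 : (k + 1).choose 2 = k + k.choose 2 := by
      rw [Nat.choose_succ_succ' k 1, Nat.choose_one_right]
    rw [e6]
    calc _ = qPoch (q ^ (-((k + 1 + m : ℕ) : ℤ))) q k * q ^ ((k + 1 + m) * k) * qPoch q q m *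
          ((1 - q ^ (-((k + 1 + m : ℕ) : ℤ)) * q ^ k) * q ^ (k + 1 + m)) := by ring
      _ = -q ^ k * (qPoch (q ^ (-((k + 1 + m : ℕ) : ℤ))) q k * q ^ ((k + 1 + m) * k) *
          (qPoch q q m * (1 - q * q ^ m))) := by rw [e4]; ring
      _ = _ := by rw [ih']; ring

/-- The continuous `q`-Hermite polynomials have their standard hypergeometric expression, with
`x = (z + z⁻¹) / 2` and `z = e^{iθ}`. -/
theorem eval_qHermite (h2 : (2 : K) ≠ 0) {q z : K} (hq0 : q ≠ 0)
    (hq : ∀ m : ℕ, q ^ (m + 1) ≠ 1) (hz : z ≠ 0) (n : ℕ) :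
    (qHermite q n).eval ((z + z⁻¹) / 2) =
      z ^ n / 2 ^ n * qHyper [q ^ (-(n : ℤ)), 0] [] q (q ^ n * z ^ (-2 : ℤ)) n := by
  have hT : ∀ m : ℤ, (Polynomial.Chebyshev.T K m).eval ((z + z⁻¹) / 2) =
      2⁻¹ * (z ^ m + z ^ (-m)) := by
    intro m
    rw [← two_mul_eval_T h2 z hz m, inv_mul_cancel_left₀ h2]
  set B : ℕ → K := fun k => qPoch q q n / (qPoch q q k * qPoch q q (n - k)) with hB
  have hsymm : ∑ k ∈ Finset.range (n + 1), B k * z ^ (-((n : ℤ) - 2 * (k : ℤ))) =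
      ∑ k ∈ Finset.range (n + 1), B k * z ^ ((n : ℤ) - 2 * (k : ℤ)) := by
    rw [← Finset.sum_range_reflect (fun k => B k * z ^ (-((n : ℤ) - 2 * (k : ℤ)))) (n + 1)]
    refine Finset.sum_congr rfl fun k hk => ?_
    have hk' : k ≤ n := by have := Finset.mem_range.1 hk; omega
    have e : n + 1 - 1 - k = n - k := by omega
    have e' : n - (n - k) = k := by omega
    rw [e]
    congr 1
    · simp only [hB, e', mul_comm]
    · congr 1
      push_cast [Nat.cast_sub hk']
      ring
  have hL : (qHermite q n).eval ((z + z⁻¹) / 2) =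
      (2 ^ n)⁻¹ * ∑ k ∈ Finset.range (n + 1), B k * z ^ ((n : ℤ) - 2 * (k : ℤ)) := by
    simp only [qHermite, Polynomial.eval_mul, Polynomial.eval_C, Polynomial.eval_finsetSum, hT]
    congr 1
    have : ∀ k : ℕ, qPoch q q n / (qPoch q q k * qPoch q q (n - k)) *
        (2⁻¹ * (z ^ ((n : ℤ) - 2 * (k : ℤ)) + z ^ (-((n : ℤ) - 2 * (k : ℤ))))) =
        2⁻¹ * (B k * z ^ ((n : ℤ) - 2 * (k : ℤ)) + B k * z ^ (-((n : ℤ) - 2 * (k : ℤ)))) := by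
      intro k; simp only [hB]; ring
    rw [Finset.sum_congr rfl fun k _ => this k, ← Finset.mul_sum, Finset.sum_add_distrib, hsymm,
      ← two_mul, inv_mul_cancel_left₀ h2]
  rw [hL, qHyper, div_eq_mul_inv, mul_comm (z ^ n) _, mul_assoc, Finset.mul_sum _ _ (z ^ n)]
  congr 1
  refine Finset.sum_congr rfl fun k hk => ?_
  have hk' : k ≤ n := by have := Finset.mem_range.1 hk; omega
  have h0 : qPoch (0 : K) q k = 1 := by simp [qPoch]
  have hP := qPoch_neg hq0 n k hk'
  have n1 := qPoch_self_ne_zero hq k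
  have n2 := qPoch_self_ne_zero hq (n - k)
  have n3 : ((-1 : K) ^ k * q ^ k.choose 2) ≠ 0 :=
    mul_ne_zero (pow_ne_zero _ (neg_ne_zero.2 one_ne_zero)) (pow_ne_zero _ hq0)
  have e1 : (1 + (([] : List K).length : ℤ) - ([q ^ (-(n : ℤ)), 0].length : ℤ)) = -1 := by simp
  rw [e1]
  simp only [List.map_cons, List.map_nil, List.prod_cons, List.prod_nil, h0, mul_one, zpow_neg_one]
  have e2 : z ^ ((n : ℤ) - 2 * (k : ℤ)) = z ^ n * (z ^ (-2 : ℤ)) ^ k := by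
    rw [← zpow_natCast (z ^ (-2 : ℤ)), ← zpow_mul, ← zpow_natCast z n, ← zpow_add₀ hz]
    congr 1
  rw [e2, mul_pow, ← pow_mul]
  have e3 : B k = qPoch (q ^ (-(n : ℤ))) q k / qPoch q q k *
      ((-1) ^ k * q ^ k.choose 2)⁻¹ * q ^ (n * k) := by
    simp only [hB]
    rw [div_eq_iff (mul_ne_zero n1 n2)]
    have : qPoch q q n = qPoch (q ^ (-(n : ℤ))) q k * q ^ (n * k) * qPoch q q (n - k) *
        ((-1) ^ k * q ^ k.choose 2)⁻¹ := by
      rw [hP, mul_assoc, mul_inv_cancel₀ n3, mul_one]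
    rw [this]
    field_simp
  rw [e3]
  ring

/-- Parameters for which all the polynomials `p_n(x; a, b, c, d | q)` are given by a meaningful
formula: no denominator in their definition vanishes and `p_n` has degree `n`. -/
structure IsGeneric (a b c d q : K) : Prop where
  two_ne_zero : (2 : K) ≠ 0
  a_ne_zero : a ≠ 0
  q_ne_zero : q ≠ 0
  q_pow : ∀ m : ℕ, q ^ (m + 1) ≠ 1
  ab : ∀ m : ℕ, a * b * q ^ m ≠ 1
  ac : ∀ m : ℕ, a * c * q ^ m ≠ 1
  ad : ∀ m : ℕ, a * d * q ^ m ≠ 1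
  abcd : ∀ m : ℕ, a * b * c * d * q ^ m ≠ 1

theorem qPoch_ne_zero {x q : K} {n : ℕ} (h : ∀ m < n, x * q ^ m ≠ 1) : qPoch x q n ≠ 0 :=
  Finset.prod_ne_zero_iff.2 fun j hj e => h j (Finset.mem_range.1 hj) (sub_eq_zero.1 e).symm

theorem degree_awFactor {a b c d q : K} (h : IsGeneric a b c d q) (k : ℕ) :
    (awFactor a q k).degree = k := by
  have hj : ∀ j : ℕ, (1 - Polynomial.C (2 * a * q ^ j) * Polynomial.X +
      Polynomial.C (a ^ 2 * q ^ (2 * j)) : K[X]).degree = 1 := by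
    intro j
    have e : (1 - Polynomial.C (2 * a * q ^ j) * Polynomial.X +
        Polynomial.C (a ^ 2 * q ^ (2 * j)) : K[X]) =
        Polynomial.C (-(2 * a * q ^ j)) * Polynomial.X +
          Polynomial.C (1 + a ^ 2 * q ^ (2 * j)) := by
      simp only [Polynomial.C_neg, Polynomial.C_add, Polynomial.C_1]
      ring
    rw [e]
    exact Polynomial.degree_linear (neg_ne_zero.2
      (mul_ne_zero (mul_ne_zero h.two_ne_zero h.a_ne_zero) (pow_ne_zero _ h.q_ne_zero)))
  rw [awFactor, Polynomial.degree_prod, Finset.sum_congr rfl fun j _ => hj j]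
  simp

theorem degree_askeyWilson {a b c d q : K} (h : IsGeneric a b c d q) (n : ℕ) :
    (askeyWilson a b c d q n).degree = n := by
  have hab : ∀ k, qPoch (a * b) q k ≠ 0 := fun k => qPoch_ne_zero fun m _ => h.ab m
  have hac : ∀ k, qPoch (a * c) q k ≠ 0 := fun k => qPoch_ne_zero fun m _ => h.ac m
  have had : ∀ k, qPoch (a * d) q k ≠ 0 := fun k => qPoch_ne_zero fun m _ => h.ad m
  have hqq := qPoch_self_ne_zero h.q_pow
  have habcd : qPoch (a * b * c * d * q ^ ((n : ℤ) - 1)) q n ≠ 0 := by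
    refine qPoch_ne_zero fun m hm => ?_
    have e : ((n : ℤ) - 1) = ((n - 1 : ℕ) : ℤ) := by omega
    rw [e, zpow_natCast, mul_assoc _ (q ^ _) (q ^ m), ← pow_add]
    exact h.abcd _
  have hqn : qPoch (q ^ (-(n : ℤ))) q n ≠ 0 := by
    refine qPoch_ne_zero fun m hm e => ?_
    obtain ⟨r, rfl⟩ : ∃ r, n = m + 1 + r := ⟨n - (m + 1), by omega⟩
    rw [zpow_neg, zpow_natCast, inv_mul_eq_one₀ (pow_ne_zero _ h.q_ne_zero)] at e
    have e' : q ^ (m + 1 + r) = q ^ m * q ^ (r + 1) := by ring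
    rw [e', mul_eq_left₀ (pow_ne_zero _ h.q_ne_zero)] at e
    exact h.q_pow r e
  rw [askeyWilson, Polynomial.degree_C_mul]
  · rw [Finset.sum_range_succ, Polynomial.degree_add_eq_right_of_degree_lt]
    · rw [Polynomial.degree_C_mul, degree_awFactor h]
      exact mul_ne_zero (div_ne_zero (mul_ne_zero hqn habcd)
        (mul_ne_zero (hqq n) (mul_ne_zero (mul_ne_zero (hab n) (hac n)) (had n))))
        (pow_ne_zero _ h.q_ne_zero)
    · rw [Polynomial.degree_C_mul, degree_awFactor h]
      · rw [← Polynomial.mem_degreeLT]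
        refine Submodule.sum_mem _ fun k hk => ?_
        rw [Polynomial.mem_degreeLT, ← Polynomial.smul_eq_C_mul]
        refine (Polynomial.degree_smul_le _ _).trans_lt ?_
        rw [degree_awFactor h]
        exact_mod_cast Finset.mem_range.1 hk
      · exact mul_ne_zero (div_ne_zero (mul_ne_zero hqn habcd)
          (mul_ne_zero (hqq n) (mul_ne_zero (mul_ne_zero (hab n) (hac n)) (had n))))
          (pow_ne_zero _ h.q_ne_zero)
  · exact div_ne_zero (mul_ne_zero (mul_ne_zero (hab n) (hac n)) (had n))
      (mul_ne_zero (pow_ne_zero _ (mul_ne_zero h.two_ne_zero h.a_ne_zero)) habcd)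

/-- The Askey–Wilson polynomials as a sequence of polynomials with `deg p_n = n`. -/
def awSequence {a b c d q : K} (h : IsGeneric a b c d q) : Polynomial.Sequence K where
  elems' := askeyWilson a b c d q
  degree_eq' := degree_askeyWilson h

/-- The mixed moments `σ_{n,k}` of a sequence `P` of polynomials with `deg P_k = k`, relative to
the sequence `Q`: the coefficients in `Q_n = ∑_k σ_{n,k} P_k`. -/
def mixedMoment (P : Polynomial.Sequence K) (Q : ℕ → K[X]) (n k : ℕ) : K :=
  (P.basis fun i => (Polynomial.leadingCoeff_ne_zero.2 (P.ne_zero i)).isUnit).repr (Q n) k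

/-- If `deg Q_n ≤ n`, the mixed moments are characterized by `Q_n = ∑_{k ≤ n} σ_{n,k} P_k`
together with `σ_{n,k} = 0` for `n < k`. -/
theorem eq_mixedMoment_iff (P : Polynomial.Sequence K) (Q : ℕ → K[X])
    (hQ : ∀ n, (Q n).degree ≤ n) (σ : ℕ → ℕ → K) :
    σ = mixedMoment P Q ↔ (∀ n k, n < k → σ n k = 0) ∧
      ∀ n, Q n = ∑ k ∈ Finset.range (n + 1), Polynomial.C (σ n k) * P k := by
  set B := P.basis fun i => (Polynomial.leadingCoeff_ne_zero.2 (P.ne_zero i)).isUnit with hB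
  have key : ∀ n, ∀ s : ℕ → K, (∀ k, n < k → s k = 0) →
      Q n = ∑ k ∈ Finset.range (n + 1), Polynomial.C (s k) * P k → s = mixedMoment P Q n := by
    intro n s hs e
    funext k
    rw [mixedMoment, e, map_sum, Finsupp.finsetSum_apply]
    have : ∀ j, (B.repr (Polynomial.C (s j) * P j)) k = if j = k then s j else 0 := by
      intro j
      rw [← Polynomial.smul_eq_C_mul, map_smul,
        ← P.basis_eq_self (fun i => (Polynomial.leadingCoeff_ne_zero.2 (P.ne_zero i)).isUnit) j,
        ← hB, Module.Basis.repr_self]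
      simp [Finsupp.single_apply]
    rw [Finset.sum_congr rfl fun j _ => this j, Finset.sum_ite_eq']
    split_ifs with hk
    · rfl
    · exact hs k (by simpa using hk)
  have ex : ∀ n, ∃ s : ℕ → K, (∀ k, n < k → s k = 0) ∧
      Q n = ∑ k ∈ Finset.range (n + 1), Polynomial.C (s k) * P k := by
    intro n
    have hm : Q n ∈ Submodule.span K (P '' ↑(Finset.range (n + 1))) := by
      have e : (↑(Finset.range (n + 1)) : Set ℕ) = Set.Iic n := by ext; simp
      rw [e, P.span_degreeLE fun i _ =>
        (Polynomial.leadingCoeff_ne_zero.2 (P.ne_zero i)).isUnit]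
      exact Polynomial.mem_degreeLE.2 (hQ n)
    obtain ⟨f, hf⟩ := (Submodule.mem_span_image_finset_iff_exists_fun K).1 hm
    refine ⟨fun k => if hk : k ∈ Finset.range (n + 1) then f ⟨k, hk⟩ else 0, fun k hk => dif_neg (by simp; omega), ?_⟩
    rw [← hf, ← Finset.sum_coe_sort (Finset.range (n + 1))]
    refine Finset.sum_congr rfl fun k _ => ?_
    simp only [dif_pos k.2, Polynomial.smul_eq_C_mul]
  constructor
  · rintro rfl
    refine ⟨fun n k hk => ?_, fun n => ?_⟩
    · obtain ⟨s, hs, e⟩ := ex n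
      rw [← key n s hs e]
      exact hs k hk
    · obtain ⟨s, hs, e⟩ := ex n
      rw [← key n s hs e]
      exact e
  · rintro ⟨h0, h1⟩
    funext n
    exact key n (σ n) (h0 n) (h1 n)

theorem degree_qHermite_le (h2 : (2 : K) ≠ 0) (q : K) (n : ℕ) :
    (qHermite q n).degree ≤ n := by
  have : NeZero (2 : K) := ⟨h2⟩
  rw [← Polynomial.mem_degreeLE, qHermite, ← Polynomial.smul_eq_C_mul]
  refine Submodule.smul_mem _ _ (Submodule.sum_mem _ fun k hk => ?_)
  rw [← Polynomial.smul_eq_C_mul]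
  refine Submodule.smul_mem _ _ (Polynomial.mem_degreeLE.2 ?_)
  rw [Polynomial.Chebyshev.degree_T]
  have := Finset.mem_range.1 hk
  exact_mod_cast (by omega : ((n : ℤ) - 2 * (k : ℤ)).natAbs ≤ n)

/-- The mixed moments `σ^{AW,H}_{n,k}(a, b, c, d; q)` of the Askey–Wilson polynomials relative to
the continuous `q`-Hermite polynomials. -/
def sigmaAWH {a b c d q : K} (h : IsGeneric a b c d q) (n k : ℕ) : K :=
  mixedMoment (awSequence h) (qHermite q) n k

/-- The defining expansion `H_n(x | q) = ∑_{k ≤ n} σ^{AW,H}_{n,k} p_k(x; a, b, c, d | q)`, with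
`σ^{AW,H}_{n,k} = 0` for `n < k`, and its uniqueness. -/
theorem eq_sigmaAWH_iff {a b c d q : K} (h : IsGeneric a b c d q) (σ : ℕ → ℕ → K) :
    σ = sigmaAWH h ↔ (∀ n k, n < k → σ n k = 0) ∧
      ∀ n, qHermite q n =
        ∑ k ∈ Finset.range (n + 1), Polynomial.C (σ n k) * askeyWilson a b c d q k :=
  eq_mixedMoment_iff (awSequence h) (qHermite q) (degree_qHermite_le h.two_ne_zero q) σ

end Polynomials

section PowerSeries

/-- Formal power series over `ℂ` in five variables, numbered `0, 1, 2, 3, 4` and denoted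
`a, b, c, d, q`. -/
abbrev PS : Type := MvPowerSeries (Fin 5) ℂ

/-- The field of fractions of the ring of formal power series in `a, b, c, d, q`; it contains the
field of rational functions in `a, b, c, d, q`. -/
abbrev PSField : Type := FractionRing PS

/-- The variables `a, b, c, d, q` (for `s = 0, 1, 2, 3, 4`) as elements of the field. -/
def var (s : Fin 5) : PSField := algebraMap PS PSField (MvPowerSeries.X s)

/-- The imaginary unit `√-1` as an element of the field. -/
def im : PSField := algebraMap PS PSField (MvPowerSeries.C Complex.I)

theorem im_mul_im : im * im = -1 := by
  rw [im, ← map_mul, ← map_mul, Complex.I_mul_I]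
  simp

theorem algebraMap_ne_one {f : PS} (hf : MvPowerSeries.constantCoeff f = 0) :
    algebraMap PS PSField f ≠ 1 := by
  intro h
  rw [← map_one (algebraMap PS PSField)] at h
  have := IsFractionRing.injective PS PSField h
  rw [this] at hf
  simp at hf

theorem var_ne_zero (s : Fin 5) : var s ≠ 0 := by
  intro h
  rw [var, ← map_zero (algebraMap PS PSField)] at h
  have h' := congrArg (MvPowerSeries.coeff (Finsupp.single s 1))
    (IsFractionRing.injective PS PSField h)
  rw [MvPowerSeries.coeff_index_single_self_X, map_zero] at h'
  exact one_ne_zero h'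

/-- The substituted parameters `(√-1 a, √-1 b, √-1 c, √-1 d; q)` are generic. -/
theorem isGeneric : IsGeneric (im * var 0) (im * var 1) (im * var 2) (im * var 3) (var 4) where
  two_ne_zero h := by
    rw [← map_ofNat (algebraMap PS PSField) 2, ← map_zero (algebraMap PS PSField)] at h
    have h' := congrArg (MvPowerSeries.constantCoeff)
      (IsFractionRing.injective PS PSField h)
    rw [map_ofNat, map_zero] at h'
    exact two_ne_zero h'
  a_ne_zero := mul_ne_zero (fun h => by simpa [h] using im_mul_im) (var_ne_zero 0)
  q_ne_zero := var_ne_zero 4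
  q_pow m := by
    simp only [var, ← map_pow]
    exact algebraMap_ne_one (by simp)
  ab m := by
    simp only [im, var, ← map_mul, ← map_pow]
    exact algebraMap_ne_one (by simp)
  ac m := by
    simp only [im, var, ← map_mul, ← map_pow]
    exact algebraMap_ne_one (by simp)
  ad m := by
    simp only [im, var, ← map_mul, ← map_pow]
    exact algebraMap_ne_one (by simp)
  abcd m := by
    simp only [im, var, ← map_mul, ← map_pow]
    exact algebraMap_ne_one (by simp)

/-- The rescaled mixed moments
`(2 / √-1)^{n-k} σ^{AW,H}_{n,k}(√-1 a, √-1 b, √-1 c, √-1 d; q)`. -/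
def rescaledMoment (n k : ℕ) : PSField :=
  (2 / im) ^ ((n : ℤ) - (k : ℤ)) * sigmaAWH isGeneric n k

/-- An element of the field is a formal power series in `a, b, c, d, q` with nonnegative integer
coefficients. -/
def IsNonnegIntPowerSeries (x : PSField) : Prop :=
  ∃ f : MvPowerSeries (Fin 5) ℕ,
    x = algebraMap PS PSField (MvPowerSeries.map (Nat.castRingHom ℂ) f)

end PowerSeries

end AskeyWilson

end

open scoped Polynomial

noncomputable section

/-! The moment matrix is a product of four lower triangular matrices, obtained by switching on the
parameters `a, b, c, d` one at a time, starting from the `q`-Hermite polynomials. The first factor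
(`qHermite_eq_sum`) comes from comparing three-term recurrences. The other three are connection
matrices in which only the last Askey–Wilson parameter changes from `0` (`askeyWilson_d_zero`), and
they follow from the `q`-Chu–Vandermonde sum. Replacing `a, b, c, d` by their multiples by `√-1`
turns each `(xy q^k; q)_m` into `(-xy q^k; q)_m` and preserves the sign of `abcd`. The factors
become `wMat`, with entries `[n choose k]_q ω_k ⋯ ω_{n-1}`, and `gMat`, which carries the additional
quotient `(-u q^k; q)_{n-k} / (uv q^{2k}; q)_{n-k}` with `u = ab`, `v = cd`.

Pascal's rule factors `wMat` into bidiagonal matrices with nonnegative entries, so multiplying by it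
on the right preserves nonnegativity of minors (`IsTotallyPositive.lmul_wMat`). For `gMat`, a second
Chu–Vandermonde sum gives `gMat(u, v, β) = wMat(β) · gMat(v, u, β_i u q^i)` (`gMat_eq_lmul`).
Applying it twice returns `u, v` to their places and multiplies `β_i` by `uv q^{2i}`. Iterating,
`gMat` becomes an infinite product of matrices `wMat`, convergent in the topology of formal power
series because the remainder tends to the identity (`isTotallyPositive_lmul_gMat`). -/

namespace AskeyWilson

/-! ### Gaussian binomial coefficients over a semiring. -/

section QBinomial

/-- The Gaussian binomial coefficient. -/
def qBinom {R : Type*} [CommSemiring R] (q : R) : ℕ → ℕ → R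
  | _, 0 => 1
  | 0, _ + 1 => 0
  | n + 1, k + 1 => qBinom q n k + q ^ (k + 1) * qBinom q n (k + 1)

variable {R : Type*} [CommSemiring R]

@[simp] theorem qBinom_zero_right (q : R) (n : ℕ) : qBinom q n 0 = 1 := by
  cases n <;> rfl

theorem qBinom_succ_succ (q : R) (n k : ℕ) :
    qBinom q (n + 1) (k + 1) = qBinom q n k + q ^ (k + 1) * qBinom q n (k + 1) := rfl

theorem qBinom_eq_zero (q : R) {n k : ℕ} (h : n < k) : qBinom q n k = 0 := by
  induction n generalizing k with
  | zero => obtain ⟨k, rfl⟩ := Nat.exists_eq_succ_of_ne_zero h.ne'; rfl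
  | succ n ih =>
    obtain ⟨k, rfl⟩ := Nat.exists_eq_succ_of_ne_zero (Nat.ne_zero_of_lt h)
    rw [Nat.succ_eq_add_one, qBinom_succ_succ, ih (by omega), ih (by omega)]
    simp

@[simp] theorem qBinom_self (q : R) (n : ℕ) : qBinom q n n = 1 := by
  induction n with
  | zero => rfl
  | succ n ih => rw [qBinom_succ_succ, ih, qBinom_eq_zero q (by omega)]; simp

theorem map_qBinom {R' : Type*} [CommSemiring R'] (f : R →+* R') (q : R) (n k : ℕ) :
    f (qBinom q n k) = qBinom (f q) n k := by
  induction n generalizing k with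
  | zero => cases k <;> simp [qBinom]
  | succ n ih => cases k <;> simp [qBinom, ih]

end QBinomial

/-! ### Quotient formulas for Gaussian binomials and two `q`-Chu–Vandermonde sums. -/

section QBinomialField

variable {K : Type*} [Field K]

theorem qBinom_mul_qPoch (q : K) (m k : ℕ) :
    qBinom q (m + k) k * (qPoch q q k * qPoch q q m) = qPoch q q (m + k) := by
  induction k generalizing m with
  | zero => simp [qPoch]
  | succ k ih =>
    induction m with
    | zero => simp [qPoch]
    | succ m ihm =>
      have h1 := ih (m + 1)
      have e1 : m + 1 + (k + 1) = (m + 1 + k) + 1 := by ring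
      have e2 : m + (k + 1) = m + 1 + k := by ring
      rw [e2] at ihm
      rw [e1, qBinom_succ_succ, qPoch_succ q q k, qPoch_succ q q (m + 1 + k)]
      rw [qPoch_succ] at h1 ihm ⊢
      linear_combination (1 - q * q ^ k) * h1 + q ^ (k + 1) * (1 - q * q ^ m) * ihm

theorem qBinom_eq_div {q : K} (hq : ∀ m : ℕ, q ^ (m + 1) ≠ 1) {n k : ℕ} (h : k ≤ n) :
    qBinom q n k = qPoch q q n / (qPoch q q k * qPoch q q (n - k)) := by
  rw [eq_div_iff (mul_ne_zero (qPoch_self_ne_zero hq _) (qPoch_self_ne_zero hq _))]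
  obtain ⟨m, rfl⟩ := Nat.exists_eq_add_of_le' h
  rw [Nat.add_sub_cancel, qBinom_mul_qPoch]

theorem qBinom_succ_succ' {q : K} (hq : ∀ m : ℕ, q ^ (m + 1) ≠ 1) {n k : ℕ} (h : k ≤ n) :
    qBinom q (n + 1) (k + 1) = q ^ (n - k) * qBinom q n k + qBinom q n (k + 1) := by
  obtain ⟨m, rfl⟩ := Nat.exists_eq_add_of_le' h
  rw [Nat.add_sub_cancel]
  cases m with
  | zero => simp [qBinom_eq_zero]
  | succ m =>
    rw [qBinom_eq_div hq (by omega), qBinom_eq_div hq (by omega), qBinom_eq_div hq (by omega)]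
    have e1 : m + 1 + k + 1 - (k + 1) = m + 1 := by omega
    have e2 : m + 1 + k - k = m + 1 := by omega
    have e3 : m + 1 + k - (k + 1) = m := by omega
    rw [e1, e2, e3, qPoch_succ q q (m + 1 + k), qPoch_succ q q k, qPoch_succ q q m]
    have h1 := qPoch_self_ne_zero hq k
    have h2 := qPoch_self_ne_zero hq m
    have h3 : 1 - q * q ^ k ≠ 0 := sub_ne_zero.2 (by rw [← pow_succ']; exact (hq k).symm)
    have h4 : 1 - q * q ^ m ≠ 0 := sub_ne_zero.2 (by rw [← pow_succ']; exact (hq m).symm)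
    field_simp
    ring

theorem one_sub_mul_qBinom {q : K} (hq : ∀ m : ℕ, q ^ (m + 1) ≠ 1) (n k : ℕ) :
    (1 - q ^ (k + 1)) * qBinom q (n + 1) (k + 1) = (1 - q ^ (n + 1)) * qBinom q n k := by
  rcases lt_or_ge n k with h | h
  · rw [qBinom_eq_zero q h, qBinom_eq_zero q (by omega)]; simp
  rw [qBinom_eq_div hq (by omega), qBinom_eq_div hq h, Nat.add_sub_add_right,
    qPoch_succ q q n, qPoch_succ q q k]
  have h1 := qPoch_self_ne_zero hq k
  have h2 := qPoch_self_ne_zero hq (n - k)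
  have h3 : 1 - q * q ^ k ≠ 0 := sub_ne_zero.2 (by rw [← pow_succ']; exact (hq k).symm)
  field_simp
  ring

/-- Used to multiply triangular matrices with Gaussian binomial entries: the factor depending only
on the outer indices comes out of the sum, leaving a single binomial in the summation index. -/
theorem qBinom_mul_qBinom {q : K} (hq : ∀ m : ℕ, q ^ (m + 1) ≠ 1) (k m r : ℕ) :
    qBinom q (k + m + r) (k + m) * qBinom q (k + m) k =
      qBinom q (k + m + r) k * qBinom q (m + r) m := by
  rw [qBinom_eq_div hq (by omega), qBinom_eq_div hq (by omega), qBinom_eq_div hq (by omega),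
    qBinom_eq_div hq (by omega)]
  have e1 : k + m + r - (k + m) = r := by omega
  have e2 : k + m - k = m := by omega
  have e3 : k + m + r - k = m + r := by omega
  have e4 : m + r - m = r := by omega
  rw [e1, e2, e3, e4]
  have h := qPoch_self_ne_zero hq
  have h1 := h k
  have h2 := h m
  have h3 := h r
  have h4 := h (k + m)
  have h5 := h (m + r)
  field_simp

theorem qPoch_succ_left (x q : K) (n : ℕ) :
    qPoch x q (n + 1) = (1 - x) * qPoch (x * q) q n := by
  rw [qPoch, Finset.prod_range_succ', mul_comm, qPoch]
  simp only [pow_zero, mul_one]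
  congr 1
  exact Finset.prod_congr rfl fun j _ => by ring

theorem qPoch_add (x q : K) (m n : ℕ) :
    qPoch x q (m + n) = qPoch x q m * qPoch (x * q ^ m) q n := by
  rw [qPoch, Finset.prod_range_add]
  simp only [qPoch, pow_add, mul_assoc]

theorem qPoch_ne_zero' {x q : K} (h : ∀ m, x * q ^ m ≠ 1) (n : ℕ) : qPoch x q n ≠ 0 :=
  qPoch_ne_zero fun m _ => h m

/-- The `q`-Chu–Vandermonde sum with argument `q`. -/
theorem qVandermonde {q : K} (hq0 : q ≠ 0) (n : ℕ) :
    ∀ b c : K, (∀ m, c * q ^ m ≠ 1) →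
    ∑ j ∈ Finset.range (n + 1), qBinom q n j * ((-1) ^ j * q ^ (j.choose 2 + j) / q ^ (n * j)) *
        (qPoch b q j / qPoch c q j) =
      (∏ i ∈ Finset.range n, (b - c * q ^ i)) / qPoch c q n := by
  induction n with
  | zero => intro b c _; simp [qPoch]
  | succ n ih =>
    intro b c hc
    have hc1 : ∀ m, c * q * q ^ m ≠ 1 := fun m => by
      rw [mul_assoc, ← pow_succ']; exact hc _
    have h1c : 1 - c ≠ 0 := sub_ne_zero.2 (by simpa using (hc 0).symm)
    have hcn : 1 - c * q ^ n ≠ 0 := sub_ne_zero.2 (hc n).symm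
    have hP := qPoch_ne_zero' hc n
    have hP1 := qPoch_ne_zero' hc1 n
    -- In Pascal's rule, the factor `q ^ (j + 1)` turns `q ^ (-(n + 1) (j + 1))` into `q ^ (-n (j +
    -- 1))`, which reproduces the sum for `n`. The other part is the sum for `n` with `b, c`
    -- replaced by `b q, c q`.
    have key : ∑ j ∈ Finset.range (n + 1 + 1), qBinom q (n + 1) j *
        ((-1) ^ j * q ^ (j.choose 2 + j) / q ^ ((n + 1) * j)) * (qPoch b q j / qPoch c q j) =
        ∑ j ∈ Finset.range (n + 1), qBinom q n j *
          ((-1) ^ j * q ^ (j.choose 2 + j) / q ^ (n * j)) * (qPoch b q j / qPoch c q j) -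
        (q ^ n)⁻¹ * ((1 - b) / (1 - c)) * ∑ j ∈ Finset.range (n + 1), qBinom q n j *
          ((-1) ^ j * q ^ (j.choose 2 + j) / q ^ (n * j)) *
            (qPoch (b * q) q j / qPoch (c * q) q j) := by
      rw [Finset.sum_range_succ', Finset.mul_sum, sub_eq_add_neg, ← Finset.sum_neg_distrib]
      have e : ∑ j ∈ Finset.range (n + 1), qBinom q n j *
          ((-1) ^ j * q ^ (j.choose 2 + j) / q ^ (n * j)) * (qPoch b q j / qPoch c q j) =
          ∑ j ∈ Finset.range (n + 1), qBinom q n (j + 1) *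
            ((-1) ^ (j + 1) * q ^ ((j + 1).choose 2 + (j + 1)) / q ^ (n * (j + 1))) *
              (qPoch b q (j + 1) / qPoch c q (j + 1)) + 1 := by
        rw [Finset.sum_range_succ', Finset.sum_range_succ (n := n), qBinom_eq_zero q (Nat.lt_succ_self n)]
        simp [qPoch]
      rw [e, add_right_comm, ← Finset.sum_add_distrib]
      congr 1
      · refine Finset.sum_congr rfl fun j _ => ?_
        have hj : (j + 1).choose 2 = j + j.choose 2 := by
          rw [Nat.choose_succ_succ' j 1, Nat.choose_one_right]
        rw [qBinom_succ_succ, hj, qPoch_succ_left b, qPoch_succ_left c]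
        have hj1 := qPoch_ne_zero' hc1 j
        have hqn : q ^ ((n + 1) * (j + 1)) = q ^ (n * j) * q ^ n * q ^ j * q := by ring
        have hqn' : q ^ (n * (j + 1)) = q ^ (n * j) * q ^ n := by ring
        rw [hqn, hqn']
        field_simp
        ring
      · simp [qPoch]
    rw [key, ih b c hc, ih (b * q) (c * q) hc1, Finset.prod_range_succ]
    have e : ∏ i ∈ Finset.range n, (b * q - c * q * q ^ i) =
        q ^ n * ∏ i ∈ Finset.range n, (b - c * q ^ i) := by
      rw [← Finset.card_range n, ← Finset.prod_const, Finset.card_range, ← Finset.prod_mul_distrib]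
      exact Finset.prod_congr rfl fun i _ => by ring
    have e' : qPoch (c * q) q n = qPoch c q n * (1 - c * q ^ n) / (1 - c) := by
      rw [eq_div_iff h1c, ← qPoch_succ, qPoch_succ_left, mul_comm]
    rw [e, e', qPoch_succ]
    field_simp
    ring

/-- The `q`-Chu–Vandermonde sum with argument `-u q ^ n`, in a form symmetric in `u` and `v`. -/
theorem qVandermonde' {q : K} (hq : ∀ m : ℕ, q ^ (m + 1) ≠ 1) (u : K) (n : ℕ) :
    ∀ v : K, (∀ m, u * v * q ^ m ≠ 1) →
    ∑ j ∈ Finset.range (n + 1), qBinom q n j * (u ^ j * q ^ j.choose 2) *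
        (qPoch (-v) q j / qPoch (u * v) q j) = qPoch (-u) q n / qPoch (u * v) q n := by
  induction n with
  | zero => intro v _; simp [qPoch]
  | succ n ih =>
    intro v hv
    have hv1 : ∀ m, u * (v * q) * q ^ m ≠ 1 := fun m => by
      rw [← mul_assoc u, mul_assoc _ q, ← pow_succ']; exact hv _
    have h1c : 1 - u * v ≠ 0 := sub_ne_zero.2 (by simpa using (hv 0).symm)
    have hcn : 1 - u * v * q ^ n ≠ 0 := sub_ne_zero.2 (hv n).symm
    have hP := qPoch_ne_zero' hv n
    have hP1 := qPoch_ne_zero' hv1 n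
    -- Here the second form of Pascal's rule fits: its factor `q ^ (n - j)` combines with `q ^ (j +
    -- 1).choose 2` into `q ^ n * q ^ j.choose 2`, so this part is the sum for `n` with `v q` in
    -- place of `v` and `u` unchanged.
    have key : ∑ j ∈ Finset.range (n + 1 + 1), qBinom q (n + 1) j * (u ^ j * q ^ j.choose 2) *
          (qPoch (-v) q j / qPoch (u * v) q j) =
        ∑ j ∈ Finset.range (n + 1), qBinom q n j * (u ^ j * q ^ j.choose 2) *
          (qPoch (-v) q j / qPoch (u * v) q j) +
        u * q ^ n * ((1 + v) / (1 - u * v)) * ∑ j ∈ Finset.range (n + 1), qBinom q n j *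
          (u ^ j * q ^ j.choose 2) * (qPoch (-(v * q)) q j / qPoch (u * (v * q)) q j) := by
      rw [Finset.sum_range_succ', Finset.mul_sum]
      have e : ∑ j ∈ Finset.range (n + 1), qBinom q n j * (u ^ j * q ^ j.choose 2) *
          (qPoch (-v) q j / qPoch (u * v) q j) =
          ∑ j ∈ Finset.range (n + 1), qBinom q n (j + 1) *
            (u ^ (j + 1) * q ^ (j + 1).choose 2) *
              (qPoch (-v) q (j + 1) / qPoch (u * v) q (j + 1)) + 1 := by
        rw [Finset.sum_range_succ', Finset.sum_range_succ (n := n),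
          qBinom_eq_zero q (Nat.lt_succ_self n)]
        simp [qPoch]
      rw [e, add_right_comm, ← Finset.sum_add_distrib]
      congr 1
      · refine Finset.sum_congr rfl fun j hj => ?_
        have hjn : j ≤ n := by have := Finset.mem_range.1 hj; omega
        have hj : (j + 1).choose 2 = j + j.choose 2 := by
          rw [Nat.choose_succ_succ' j 1, Nat.choose_one_right]
        have hqn : q ^ n = q ^ (n - j) * q ^ j := by rw [← pow_add, Nat.sub_add_cancel hjn]
        have hj1 := qPoch_ne_zero' hv1 j
        rw [qBinom_succ_succ' hq hjn, hj, qPoch_succ_left (-v), qPoch_succ_left (u * v), hqn,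
          mul_assoc u v q, neg_mul]
        field_simp
        ring
      · simp [qPoch]
    rw [key, ih v hv, ih (v * q) hv1]
    have e' : qPoch (u * (v * q)) q n = qPoch (u * v) q n * (1 - u * v * q ^ n) / (1 - u * v) := by
      rw [eq_div_iff h1c, ← qPoch_succ, qPoch_succ_left, mul_comm, mul_assoc]
    rw [e', qPoch_succ, qPoch_succ]
    field_simp
    ring

end QBinomialField

/-! ### Total positivity and bidiagonal factorization. -/

section TotalPositivity

variable {R : Type*} [CommRing R]

/-- The product of matrices indexed by `ℕ`, where `M` is lower triangular. -/
def lmul (M A : ℕ → ℕ → R) (n k : ℕ) : R := ∑ m ∈ Finset.range (n + 1), M n m * A m k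

/-- The inner sum stops at a different index in the two bracketings; the missing terms vanish as
soon as the middle factor is lower triangular. -/
theorem lmul_assoc (M A B : ℕ → ℕ → R) (hA : ∀ n k, n < k → A n k = 0) :
    lmul (lmul M A) B = lmul M (lmul A B) := by
  funext n k
  simp only [lmul, Finset.sum_mul, Finset.mul_sum]
  rw [Finset.sum_comm]
  refine Finset.sum_congr rfl fun l hl => ?_
  have hl' := Finset.mem_range.1 hl
  rw [← Finset.sum_subset (s₁ := Finset.range (l + 1))]
  · exact Finset.sum_congr rfl fun m _ => by ring
  · intro m hm; have := Finset.mem_range.1 hm; exact Finset.mem_range.2 (by omega)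
  · intro m _ hm
    rw [hA l m (by simpa using hm)]
    simp

/-- All minors of `M` belong to `S`. -/
def IsTotallyPositive (S : Subsemiring R) (M : ℕ → ℕ → R) : Prop :=
  ∀ (r : ℕ) (rows cols : Fin r → ℕ), StrictMono rows → StrictMono cols →
    Matrix.det (Matrix.of fun i j => M (rows i) (cols j)) ∈ S

/-- If the row and column sets differ, some row of the minor is zero; if they agree, monotonicity
makes the enumerations equal and the minor is that of an identity matrix. -/
theorem isTotallyPositive_one (S : Subsemiring R) :
    IsTotallyPositive S fun n k => if n = k then 1 else 0 := by
  intro r rows cols hr hc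
  by_cases h : ∀ i, ∃ j, rows i = cols j
  · have h1 : Set.range rows ⊆ Set.range cols := by
      rintro _ ⟨i, rfl⟩
      obtain ⟨j, hj⟩ := h i
      exact ⟨j, hj.symm⟩
    have h2 : Set.range rows = Set.range cols := by
      refine Set.eq_of_subset_of_ncard_le h1 ?_ (Set.finite_range _)
      rw [← Set.image_univ, ← Set.image_univ, Set.ncard_image_of_injective _ hc.injective,
        Set.ncard_image_of_injective _ hr.injective]
    have h3 : rows = cols := (hr.range_inj hc).1 h2
    subst h3
    have : (Matrix.of fun i j => if rows i = rows j then (1 : R) else 0) = 1 := by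
      ext i j
      simp [Matrix.one_apply, hr.injective.eq_iff]
    rw [this, Matrix.det_one]
    exact S.one_mem
  · push Not at h
    obtain ⟨i, hi⟩ := h
    rw [Matrix.det_eq_zero_of_row_eq_zero i fun j => by simp [hi j]]
    exact S.zero_mem

/-- Adding to each column a multiple of the next one with coefficients in `S` keeps the minors with
the given rows in `S`. -/
theorem det_mem_of_column_operation (S : Subsemiring R) (M M' : ℕ → ℕ → R) (e : ℕ → R)
    (he : ∀ k, e k ∈ S) {r : ℕ} (rows : Fin r → ℕ)
    (hM : ∀ cols : Fin r → ℕ, StrictMono cols →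
      Matrix.det (Matrix.of fun i j => M (rows i) (cols j)) ∈ S)
    (h : ∀ n k, M' n k = M n k + e k * M n (k + 1)) (cols : Fin r → ℕ) (hc : StrictMono cols) :
    Matrix.det (Matrix.of fun i j => M' (rows i) (cols j)) ∈ S := by
  have h1 : Matrix.det (Matrix.of fun i j => M' (rows i) (cols j)) =
      (Matrix.detRowAlternating (R := R) (n := Fin r)).toMultilinearMap
        ((fun j i => M (rows i) (cols j)) + fun j i => e (cols j) * M (rows i) (cols j + 1)) := by
    rw [← Matrix.det_transpose]
    change Matrix.det _ = Matrix.det _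
    congr 1
    ext j i
    simp [h]
  -- The multilinear expansion chooses, for each `j`, column `cols j` (when `j ∈ s`) or its
  -- successor.
  rw [h1, MultilinearMap.map_add_univ]
  refine S.sum_mem fun s _ => ?_
  have h2 : s.piecewise (fun j i => M (rows i) (cols j))
      (fun j i => e (cols j) * M (rows i) (cols j + 1)) =
      fun j => (if j ∈ s then 1 else e (cols j)) •
        fun i => M (rows i) (cols j + if j ∈ s then 0 else 1) := by
    funext j i
    by_cases hj : j ∈ s <;> simp [hj]
  rw [h2, MultilinearMap.map_smul_univ, smul_eq_mul]
  refine S.mul_mem (S.prod_mem fun j _ => ?_) ?_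
  · split_ifs
    · exact S.one_mem
    · exact he _
  have h3 : (Matrix.detRowAlternating (R := R) (n := Fin r)).toMultilinearMap
      (fun j i => M (rows i) (cols j + if j ∈ s then 0 else 1)) =
      Matrix.det (Matrix.of fun i j => M (rows i) (cols j + if j ∈ s then 0 else 1)) := by
    rw [← Matrix.det_transpose]
    rfl
  rw [h3]
  -- Raising some of the strictly increasing indices by one leaves them weakly increasing, so if
  -- strictness fails two columns coincide and the term is zero.
  by_cases hs : StrictMono fun j => cols j + if j ∈ s then 0 else 1
  · exact hM _ hs
  · simp only [StrictMono] at hs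
    push Not at hs
    obtain ⟨i, j, hij, hle⟩ := hs
    have hlt := hc hij
    have heq : cols i + (if i ∈ s then 0 else 1) = cols j + if j ∈ s then 0 else 1 := by
      split_ifs at hle ⊢ <;> omega
    rw [Matrix.det_zero_of_column_eq hij.ne fun l => by simp only [Matrix.of_apply, heq]]
    exact S.zero_mem

/-- The matrix `[n choose k]_q ω_k ⋯ ω_{n-1}`. -/
def wMat (q : R) (ω : ℕ → R) (n k : ℕ) : R := qBinom q n k * ∏ i ∈ Finset.Ico k n, ω i

theorem wMat_eq_zero (q : R) (ω : ℕ → R) {n k : ℕ} (h : n < k) : wMat q ω n k = 0 := by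
  rw [wMat, qBinom_eq_zero q h, zero_mul]

@[simp] theorem wMat_self (q : R) (ω : ℕ → R) (n : ℕ) : wMat q ω n n = 1 := by
  simp [wMat]

/-- The matrix `wMat` shifted along the diagonal by `s`. -/
def wMatShift (q : R) (ω : ℕ → R) (s n k : ℕ) : R :=
  if k < s then (if n = k then 1 else 0)
  else if n < s then 0 else qBinom q (n - s) (k - s) * ∏ i ∈ Finset.Ico k n, ω i

/-- This is Pascal's rule read as a matrix identity: the matrix at `s` is the matrix at `s + 1`
times a unit lower bidiagonal matrix whose entry at `(k + 1, k)` is `q ^ (k - s) * ω k` for `k ≥ s`.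
-/
theorem wMatShift_succ (q : R) (ω : ℕ → R) (s n k : ℕ) :
    wMatShift q ω s n k = wMatShift q ω (s + 1) n k +
      (if k < s then 0 else q ^ (k - s) * ω k) * wMatShift q ω (s + 1) n (k + 1) := by
  rcases lt_or_ge k s with hk | hk
  · simp [wMatShift, hk, Nat.lt_succ_of_lt hk]
  obtain ⟨k, rfl⟩ := Nat.exists_eq_add_of_le hk
  have hk1 : ¬ s + k + 1 < s + 1 := by omega
  have hk2 : ¬ s + k < s := by omega
  simp only [wMatShift, hk1, hk2, if_false, Nat.add_sub_cancel_left]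
  rcases lt_or_ge n s with hn | hn
  · have : n ≠ s + k := by omega
    simp [hn, Nat.lt_succ_of_lt hn, this]
  obtain ⟨n, rfl⟩ := Nat.exists_eq_add_of_le hn
  have hn1 : ¬ s + n < s := by omega
  simp only [hn1, if_false, Nat.add_sub_cancel_left]
  cases n with
  | zero =>
    cases k with
    | zero => simp
    | succ k => simp [qBinom]
  | succ n =>
    have e1 : ¬ s + (n + 1) < s + 1 := by omega
    have e2 : s + (n + 1) - (s + 1) = n := by omega
    have e3 : s + k + 1 - (s + 1) = k := by omega
    simp only [e1, if_false, e2, e3]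
    rcases lt_or_ge n k with hnk | hnk
    · have e4 : ¬ s + k < s + 1 := by omega
      obtain ⟨k, rfl⟩ : ∃ l, k = l + 1 := ⟨k - 1, by omega⟩
      have e5 : s + (k + 1) - (s + 1) = k := by omega
      simp only [e4, if_false, e5, qBinom_succ_succ, qBinom_eq_zero q hnk]
      ring
    have hI : ∏ i ∈ Finset.Ico (s + k) (s + (n + 1)), ω i =
        ω (s + k) * ∏ i ∈ Finset.Ico (s + k + 1) (s + (n + 1)), ω i :=
      Finset.prod_eq_prod_Ico_succ_bot (by omega) _
    cases k with
    | zero =>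
      rw [hI]
      simp
    | succ k =>
      have e4 : ¬ s + (k + 1) < s + 1 := by omega
      have e5 : s + (k + 1) - (s + 1) = k := by omega
      simp only [e4, if_false, e5, qBinom_succ_succ, hI]
      ring

theorem lmul_eq_zero {M A : ℕ → ℕ → R} (hA : ∀ n k, n < k → A n k = 0) {n k : ℕ}
    (h : n < k) : lmul M A n k = 0 :=
  Finset.sum_eq_zero fun m hm => by
    rw [hA m k (by have := Finset.mem_range.1 hm; omega), mul_zero]

theorem lmul_one_apply {M : ℕ → ℕ → R} (hL : ∀ n k, n < k → M n k = 0) (n k : ℕ) :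
    lmul M (fun n k => if n = k then 1 else 0) n k = M n k := by
  simp only [lmul, mul_ite, mul_one, mul_zero, Finset.sum_ite_eq', Finset.mem_range]
  split_ifs with h
  · rfl
  · exact (hL n k (by omega)).symm

theorem one_lmul (A : ℕ → ℕ → R) : lmul (fun n k => if n = k then 1 else 0) A = A := by
  funext n k
  simp [lmul]

/-- Each bidiagonal factor acts as a column operation with coefficients in `S`. Only finitely many
of them matter for given rows: once the shift exceeds every selected row, the shifted matrix acts as
the identity on those rows. Column operations on the accumulated product replace the Cauchy–Binet
formula. -/
theorem IsTotallyPositive.lmul_wMat {S : Subsemiring R} {M : ℕ → ℕ → R}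
    (hM : IsTotallyPositive S M) (hL : ∀ n k, n < k → M n k = 0) {q : R} (hq : q ∈ S)
    {ω : ℕ → R} (hω : ∀ i, ω i ∈ S) :
    IsTotallyPositive S (lmul M (wMat q ω)) := by
  intro r rows cols hr hc
  obtain ⟨N, hN⟩ : ∃ N, ∀ i, rows i < N :=
    ⟨(∑ i, rows i) + 1, fun i => Nat.lt_succ_of_le
      (Finset.single_le_sum (fun _ _ => Nat.zero_le _) (Finset.mem_univ i))⟩
  have main : ∀ t s, s + t = N → ∀ cols : Fin r → ℕ, StrictMono cols →
      Matrix.det (Matrix.of fun i j => lmul M (wMatShift q ω s) (rows i) (cols j)) ∈ S := by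
    intro t
    induction t with
    | zero =>
      rintro s rfl cols hc
      have e : ∀ i k, lmul M (wMatShift q ω s) (rows i) k = M (rows i) k := by
        intro i k
        rw [← lmul_one_apply hL, lmul, lmul]
        refine Finset.sum_congr rfl fun m hm => ?_
        have h1 := Finset.mem_range.1 hm
        have h2 := hN i
        have h3 : m < s := by omega
        rcases lt_or_ge k s with hk | hk
        · simp [wMatShift, hk]
        · have : m ≠ k := by omega
          simp [wMatShift, hk.not_gt, h3, this]
      simp only [e]
      exact hM r rows cols hr hc
    | succ t ih =>
      intro s hs
      refine det_mem_of_column_operation S (lmul M (wMatShift q ω (s + 1))) _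
        (fun k => if k < s then 0 else q ^ (k - s) * ω k) (fun k => ?_) rows
        (ih (s + 1) (by omega)) fun n k => ?_
      · split_ifs
        · exact S.zero_mem
        · exact S.mul_mem (S.pow_mem hq _) (hω _)
      · simp only [lmul, Finset.mul_sum, ← Finset.sum_add_distrib]
        refine Finset.sum_congr rfl fun m _ => ?_
        rw [wMatShift_succ]
        ring
  have h0 : wMatShift q ω 0 = wMat q ω := by
    funext n k
    simp [wMatShift, wMat]
  rw [← h0]
  exact main N 0 (zero_add N) cols hc

end TotalPositivity

/-! ### The factorization of `gMat` that exchanges `u` and `v`. -/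

section GMat

variable {R : Type*} [CommRing R]

/-- The matrix `wMat q β n k * (-u q^k; q)_{n-k} / (u v q^{2k}; q)_{n-k}`. -/
def gMat [Inv R] (q u v : R) (β : ℕ → R) (n k : ℕ) : R :=
  wMat q β n k *
    ∏ i ∈ Finset.range (n - k), ((1 + u * q ^ (k + i)) * (1 - u * v * q ^ (2 * k + i))⁻¹)

theorem gMat_eq_zero [Inv R] (q u v : R) (β : ℕ → R) {n k : ℕ} (h : n < k) :
    gMat q u v β n k = 0 := by
  rw [gMat, wMat_eq_zero q β h, zero_mul]

variable {K : Type*} [Field K]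

theorem gMat_eq_div (q u v : K) (β : ℕ → K) (n k : ℕ) :
    gMat q u v β n k = wMat q β n k *
      (qPoch (-(u * q ^ k)) q (n - k) / qPoch (u * v * q ^ (2 * k)) q (n - k)) := by
  rw [gMat, qPoch, qPoch, ← Finset.prod_div_distrib]
  congr 1
  refine Finset.prod_congr rfl fun i _ => ?_
  rw [div_eq_mul_inv, pow_add, pow_add]
  congr 2 <;> ring

/-- For fixed `k`, `qVandermonde'` with parameters `u q ^ k` and `v q ^ k` expands the quotient of
`q`-Pochhammer symbols. The `j`-th summand carries `∏ (u q ^ i)` over `k ≤ i < k + j`, which is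
absorbed into the weights of the second factor. -/
theorem gMat_eq_lmul {q u v : K} (hq : ∀ m : ℕ, q ^ (m + 1) ≠ 1)
    (huv : ∀ m, u * v * q ^ m ≠ 1) (β : ℕ → K) :
    gMat q u v β = lmul (wMat q β) (gMat q v u fun i => β i * (u * q ^ i)) := by
  funext n k
  rcases lt_or_ge n k with h | h
  · rw [gMat_eq_zero q u v β h, lmul_eq_zero (fun _ _ => gMat_eq_zero q v u _) h]
  obtain ⟨m, rfl⟩ := Nat.exists_eq_add_of_le h
  rw [lmul, add_assoc, Finset.sum_range_add, Finset.sum_eq_zero, zero_add]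
  swap
  · intro j hj
    rw [gMat_eq_zero _ _ _ _ (Finset.mem_range.1 hj), mul_zero]
  have huv' : ∀ i, u * q ^ k * (v * q ^ k) * q ^ i ≠ 1 := fun i => by
    have e : u * q ^ k * (v * q ^ k) * q ^ i = u * v * q ^ (k + k + i) := by ring
    rw [e]
    exact huv _
  rw [gMat_eq_div, Nat.add_sub_cancel_left]
  have e : u * v * q ^ (2 * k) = u * q ^ k * (v * q ^ k) := by ring
  rw [e, ← qVandermonde' hq (u * q ^ k) m (v * q ^ k) huv', Finset.mul_sum]
  refine Finset.sum_congr rfl fun j hj => ?_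
  have hjm : j ≤ m := by have := Finset.mem_range.1 hj; omega
  obtain ⟨l, rfl⟩ := Nat.exists_eq_add_of_le hjm
  rw [gMat_eq_div, Nat.add_sub_cancel_left, wMat, wMat, wMat, Finset.prod_mul_distrib,
    ← Finset.prod_Ico_consecutive β (Nat.le_add_right k j) (by omega : k + j ≤ k + (j + l))]
  have e1 : ∏ i ∈ Finset.Ico k (k + j), (u * q ^ i) = (u * q ^ k) ^ j * q ^ j.choose 2 := by
    rw [Finset.prod_Ico_eq_prod_range, Nat.add_sub_cancel_left, Nat.choose_two_right, ← Finset.sum_range_id]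
    simp only [pow_add, ← mul_assoc, Finset.prod_mul_distrib, Finset.prod_const, Finset.card_range]
    rw [Finset.prod_pow_eq_pow_sum]
    ring
  have e2 := qBinom_mul_qBinom hq k j l
  rw [add_assoc] at e2
  rw [e1, mul_comm v u, e]
  linear_combination (-(∏ i ∈ Finset.Ico k (k + j), β i) *
    (∏ i ∈ Finset.Ico (k + j) (k + (j + l)), β i) * ((u * q ^ k) ^ j * q ^ j.choose 2) *
    (qPoch (-(v * q ^ k)) q j / qPoch (u * q ^ k * (v * q ^ k)) q j)) * e2

end GMat

/-! ### Series with nonnegative integer coefficients, and infinite products of totally positive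
matrices. -/

section PowerSeriesMinors

/-- The power series with nonnegative integer coefficients. -/
def natSeries : Subsemiring PS := (MvPowerSeries.map (σ := Fin 5) (Nat.castRingHom ℂ)).rangeS

theorem mem_natSeries {f : PS} : f ∈ natSeries ↔ ∀ m, ∃ n : ℕ, MvPowerSeries.coeff m f = n := by
  constructor
  · rintro ⟨g, rfl⟩ m
    exact ⟨MvPowerSeries.coeff m g, by simp⟩
  · intro h
    choose g hg using h
    obtain ⟨G, hG⟩ : ∃ G : MvPowerSeries (Fin 5) ℕ, ∀ m, MvPowerSeries.coeff m G = g m :=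
      ⟨g, fun _ => rfl⟩
    exact ⟨G, MvPowerSeries.ext fun m => by rw [MvPowerSeries.coeff_map, hg, hG]; rfl⟩

theorem X_mem_natSeries (s : Fin 5) : (MvPowerSeries.X s : PS) ∈ natSeries :=
  ⟨MvPowerSeries.X s, by simp⟩

/-- The coefficient of a monomial `m` is insensitive to multiples of `X s ^ (m s + 1)`, so
nonnegativity passes to `X s`-adic limits. -/
theorem mem_natSeries_of_approx {f : PS} (s : Fin 5)
    (h : ∀ j : ℕ, ∃ g ∈ natSeries, (MvPowerSeries.X s : PS) ^ j ∣ f - g) : f ∈ natSeries := by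
  rw [mem_natSeries]
  intro m
  obtain ⟨g, hg, hd⟩ := h (m s + 1)
  obtain ⟨n, hn⟩ := mem_natSeries.1 hg m
  refine ⟨n, ?_⟩
  rw [← hn, ← sub_eq_zero, ← map_sub]
  exact MvPowerSeries.X_pow_dvd_iff.1 hd m (Nat.lt_succ_self _)

theorem dvd_det_sub_det {R : Type*} [CommRing R] (x : R) {r : ℕ} (A B : Matrix (Fin r) (Fin r) R)
    (h : ∀ i j, x ∣ A i j - B i j) : x ∣ A.det - B.det := by
  rw [← Ideal.mem_span_singleton, ← Ideal.Quotient.eq, RingHom.map_det, RingHom.map_det]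
  congr 1
  ext i j
  exact Ideal.Quotient.eq.2 (Ideal.mem_span_singleton.2 (h i j))

theorem algebraMap_inv {f : PS} (hf : MvPowerSeries.constantCoeff f ≠ 0) :
    algebraMap PS PSField f⁻¹ = (algebraMap PS PSField f)⁻¹ := by
  refine eq_inv_of_mul_eq_one_left ?_
  rw [← map_mul, MvPowerSeries.inv_mul_cancel f hf, map_one]

theorem algebraMap_wMat (q : PS) (ω : ℕ → PS) (n k : ℕ) :
    algebraMap PS PSField (wMat q ω n k) =
      wMat (algebraMap PS PSField q) (fun i => algebraMap PS PSField (ω i)) n k := by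
  simp [wMat, map_qBinom]

theorem algebraMap_gMat {q u v : PS} (huv : MvPowerSeries.constantCoeff (u * v) = 0)
    (β : ℕ → PS) (n k : ℕ) :
    algebraMap PS PSField (gMat q u v β n k) =
      gMat (algebraMap PS PSField q) (algebraMap PS PSField u) (algebraMap PS PSField v)
        (fun i => algebraMap PS PSField (β i)) n k := by
  rw [gMat, gMat, map_mul, algebraMap_wMat, map_prod]
  congr 1
  refine Finset.prod_congr rfl fun i _ => ?_
  rw [map_mul, algebraMap_inv (by rw [map_sub, map_mul, huv]; simp)]
  simp

theorem algebraMap_lmul (M A : ℕ → ℕ → PS) (n k : ℕ) :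
    algebraMap PS PSField (lmul M A n k) =
      lmul (fun n k => algebraMap PS PSField (M n k)) (fun n k => algebraMap PS PSField (A n k))
        n k := by
  simp [lmul]

/-- The identity is transported from the fraction field. The vanishing constant term of `u v`
ensures that the power series inverses in `gMat` are genuine inverses and that no denominator is
zero. -/
theorem gMat_eq_lmul_series {q u v : PS} (hq : MvPowerSeries.constantCoeff q = 0)
    (huv : MvPowerSeries.constantCoeff (u * v) = 0) (β : ℕ → PS) :
    gMat q u v β = lmul (wMat q β) (gMat q v u fun i => β i * (u * q ^ i)) := by
  funext n k
  apply IsFractionRing.injective PS PSField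
  have h1 : ∀ m : ℕ, (algebraMap PS PSField q) ^ (m + 1) ≠ 1 := fun m => by
    rw [← map_pow]
    exact algebraMap_ne_one (by rw [map_pow, hq]; simp)
  have h2 : ∀ m : ℕ, algebraMap PS PSField u * algebraMap PS PSField v *
      (algebraMap PS PSField q) ^ m ≠ 1 := fun m => by
    rw [← map_pow, ← map_mul, ← map_mul]
    exact algebraMap_ne_one (by rw [map_mul, huv]; simp)
  rw [algebraMap_gMat huv, gMat_eq_lmul h1 h2, algebraMap_lmul]
  simp only [algebraMap_wMat, algebraMap_gMat (mul_comm u v ▸ huv), map_mul, map_pow]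

/-- After `j` double applications of the factorization, `2 j` matrices `wMat` have been absorbed
into a totally positive `Y`, and the remaining `gMat` has weights divisible by `u ^ j`, hence by `X
s ^ j`. Thus every minor agrees modulo `X s ^ j` with a minor of `Y`. -/
theorem isTotallyPositive_lmul_gMat {q u v : PS} (s : Fin 5)
    (hq : MvPowerSeries.constantCoeff q = 0) (hqS : q ∈ natSeries) (huS : u ∈ natSeries)
    (hvS : v ∈ natSeries) (hs : MvPowerSeries.X s ∣ u)
    {β : ℕ → PS} (hβ : ∀ i, β i ∈ natSeries)
    {M : ℕ → ℕ → PS} (hM : IsTotallyPositive natSeries M) (hL : ∀ n k, n < k → M n k = 0) :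
    IsTotallyPositive natSeries (lmul M (gMat q u v β)) := by
  have huv : MvPowerSeries.constantCoeff (u * v) = 0 := by
    obtain ⟨w, rfl⟩ := hs
    simp
  have step : ∀ j : ℕ, ∃ Y : ℕ → ℕ → PS, IsTotallyPositive natSeries Y ∧
      (∀ n k, n < k → Y n k = 0) ∧ lmul M (gMat q u v β) =
        lmul Y (gMat q u v fun i => β i * (u * v * q ^ (2 * i)) ^ j) := by
    intro j
    induction j with
    | zero => exact ⟨M, hM, hL, by simp⟩
    | succ j ih =>
      obtain ⟨Y, hY, hYL, e⟩ := ih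
      have hS : ∀ i, β i * (u * v * q ^ (2 * i)) ^ j ∈ natSeries := fun i =>
        natSeries.mul_mem (hβ i) (natSeries.pow_mem (natSeries.mul_mem
          (natSeries.mul_mem huS hvS) (natSeries.pow_mem hqS _)) _)
      have hW : ∀ ω : ℕ → PS, ∀ n k, n < k → wMat q ω n k = 0 := fun ω n k h =>
        wMat_eq_zero q ω h
      refine ⟨lmul (lmul Y (wMat q _)) (wMat q fun i => β i * (u * v * q ^ (2 * i)) ^ j *
        (u * q ^ i)), (hY.lmul_wMat hYL hqS hS).lmul_wMat (fun n k h => lmul_eq_zero (hW _) h)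
          hqS fun i => natSeries.mul_mem (hS i) (natSeries.mul_mem huS (natSeries.pow_mem hqS _)),
        fun n k h => lmul_eq_zero (hW _) h, ?_⟩
      rw [e, gMat_eq_lmul_series hq huv,
        gMat_eq_lmul_series hq (by rwa [mul_comm] : MvPowerSeries.constantCoeff (v * u) = 0),
        lmul_assoc _ _ _ (hW _), lmul_assoc _ _ _ (hW _)]
      congr 3
      congr 1
      funext i
      ring
  intro r rows cols hr hc
  refine mem_natSeries_of_approx s fun j => ?_
  obtain ⟨Y, hY, hYL, e⟩ := step j
  refine ⟨_, hY r rows cols hr hc, dvd_det_sub_det _ _ _ fun i l => ?_⟩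
  simp only [Matrix.of_apply]
  rw [e, ← lmul_one_apply hYL (rows i), lmul, lmul, ← Finset.sum_sub_distrib]
  refine Finset.dvd_sum fun m _ => ?_
  rw [← mul_sub]
  refine Dvd.dvd.mul_left ?_ _
  -- The remaining `gMat` is the identity modulo `X s ^ j`: its diagonal is `1`, and an entry
  -- strictly below the diagonal contains at least the weight with index `cols l`.
  rcases lt_trichotomy m (cols l) with h | h | h
  · rw [gMat_eq_zero _ _ _ _ h, if_neg h.ne]
    simp
  · rw [h]
    simp [gMat]
  · rw [if_neg h.ne', sub_zero, gMat, wMat]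
    refine Dvd.dvd.mul_right (Dvd.dvd.mul_left ((Dvd.dvd.mul_left ?_ _).trans
      (Finset.dvd_prod_of_mem (fun i => β i * (u * v * q ^ (2 * i)) ^ j)
        (Finset.mem_Ico.2 ⟨le_rfl, h⟩))) _) _
    exact pow_dvd_pow_of_dvd ((hs.mul_right _).mul_right _) _

end PowerSeriesMinors

/-! ### Inversion of the hypergeometric expansion of the Askey–Wilson polynomials. -/

section Connection

variable {K : Type*} [Field K]

theorem IsGeneric.with_d_zero {a b c d q : K} (h : IsGeneric a b c d q) :
    IsGeneric a b c 0 q :=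
  { h with
    ad := by simp
    abcd := by simp }

/-- The coefficients of the Askey–Wilson polynomials in the basis `awFactor a q j`. -/
def awCoeff (a b c d q : K) (n j : ℕ) : K :=
  qPoch (a * b) q n * qPoch (a * c) q n * qPoch (a * d) q n /
      ((2 * a) ^ n * qPoch (a * b * c * d * q ^ ((n : ℤ) - 1)) q n) *
    (qBinom q n j * ((-1) ^ j * q ^ (j.choose 2 + j) / q ^ (n * j)) *
      (qPoch (a * b * c * d * q ^ ((n : ℤ) - 1)) q j /
        (qPoch (a * b) q j * qPoch (a * c) q j * qPoch (a * d) q j)))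

theorem awCoeff_eq_zero (a b c d q : K) {n j : ℕ} (h : n < j) : awCoeff a b c d q n j = 0 := by
  rw [awCoeff, qBinom_eq_zero q h]
  simp

theorem askeyWilson_eq_sum {a b c d q : K} (h : IsGeneric a b c d q) (n : ℕ) :
    askeyWilson a b c d q n = ∑ j ∈ Finset.range (n + 1),
      Polynomial.C (awCoeff a b c d q n j) * awFactor a q j := by
  rw [askeyWilson, Finset.mul_sum]
  refine Finset.sum_congr rfl fun j hj => ?_
  have hjn : j ≤ n := by have := Finset.mem_range.1 hj; omega
  rw [← mul_assoc, ← Polynomial.C_mul]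
  congr 2
  have e : qBinom q n j * ((-1) ^ j * q ^ (j.choose 2 + j) / q ^ (n * j)) =
      qPoch (q ^ (-(n : ℤ))) q j / qPoch q q j * q ^ j := by
    have h1 := qPoch_neg h.q_ne_zero n j hjn
    have h2 := qPoch_self_ne_zero h.q_pow j
    have h3 := qPoch_self_ne_zero h.q_pow (n - j)
    have h4 := pow_ne_zero (n * j) h.q_ne_zero
    rw [qBinom_eq_div h.q_pow hjn, pow_add]
    field_simp
    linear_combination -q ^ j * h1
  rw [awCoeff, e]
  ring

/-- The coefficients of `awFactor a q j` in the basis of the Askey–Wilson polynomials. -/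
def awInvCoeff (a b c d q : K) (j k : ℕ) : K :=
  (-1) ^ k * (2 * a) ^ k * q ^ k.choose 2 * qBinom q j k *
    (qPoch (a * b * q ^ k) q (j - k) * qPoch (a * c * q ^ k) q (j - k) *
      qPoch (a * d * q ^ k) q (j - k) / qPoch (a * b * c * d * q ^ (2 * k)) q (j - k))

theorem awInvCoeff_eq_zero (a b c d q : K) {j k : ℕ} (h : j < k) :
    awInvCoeff a b c d q j k = 0 := by
  rw [awInvCoeff, qBinom_eq_zero q h]
  simp

theorem mul_pow_ne_one {x q : K} (h : ∀ m, x * q ^ m ≠ 1) (k : ℕ) (m : ℕ) :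
    x * q ^ k * q ^ m ≠ 1 := by
  rw [mul_assoc, ← pow_add]
  exact h _

theorem choose_two_add (k m : ℕ) : (k + m).choose 2 = k.choose 2 + m.choose 2 + k * m := by
  induction m with
  | zero => simp
  | succ m ih =>
    rw [← add_assoc, Nat.choose_succ_succ' (k + m) 1, Nat.choose_succ_succ' m 1, ih,
      Nat.choose_one_right, Nat.choose_one_right]
    ring

theorem choose_two_add_self (k : ℕ) : k.choose 2 + k + k.choose 2 = k * k := by
  induction k with
  | zero => simp
  | succ k ih =>
    rw [Nat.choose_succ_succ' k 1, Nat.choose_one_right]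
    linarith

/-- Moving the summation index by `k` preserves the shape of the weight in `qVandermonde`: the cross
term `k m` from the binomial exponent cancels against the one from the denominator. -/
theorem pow_qVandermonde {q : K} (hq0 : q ≠ 0) (k m n : ℕ) :
    ((-1) ^ (k + m) * q ^ ((k + m).choose 2 + (k + m)) / q ^ ((k + n) * (k + m)) : K) =
      (-1) ^ k * q ^ (k.choose 2 + k) / q ^ ((k + n) * k) *
        ((-1) ^ m * q ^ (m.choose 2 + m) / q ^ (n * m)) := by
  rw [choose_two_add]
  field_simp
  ring

theorem qPoch_zero_left (q : K) (n : ℕ) : qPoch 0 q n = 1 := by simp [qPoch]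

theorem IsGeneric.qPoch_abcd_ne_zero {a b c d q : K} (h : IsGeneric a b c d q) (n : ℕ) :
    qPoch (a * b * c * d * q ^ ((n : ℤ) - 1)) q n ≠ 0 := by
  refine qPoch_ne_zero fun m hm => ?_
  have e : ((n : ℤ) - 1) = ((n - 1 : ℕ) : ℤ) := by omega
  rw [e, zpow_natCast, mul_assoc _ (q ^ _) (q ^ m), ← pow_add]
  exact h.abcd _

/-- The extra parameter `y` serves two cases, in both of which the sum becomes summable by
`qVandermonde`. For `y = d` the symbols in `a d` and `a y` cancel, giving the inverse relation; for
`y = 0` the symbols containing `y` are `1`, giving the connection coefficients. -/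
theorem sum_awCoeff_mul {a b c d y q : K} (h : IsGeneric a b c d q) (hy : IsGeneric a b c y q)
    (k n : ℕ) :
    ∑ j ∈ Finset.range (k + n + 1), awCoeff a b c y q (k + n) j * awInvCoeff a b c d q j k =
      awCoeff a b c y q (k + n) k * ((-1) ^ k * (2 * a) ^ k * q ^ k.choose 2) *
        ∑ m ∈ Finset.range (n + 1),
          qBinom q n m * ((-1) ^ m * q ^ (m.choose 2 + m) / q ^ (n * m)) *
          (qPoch (a * b * c * y * q ^ (((k + n : ℕ) : ℤ) - 1) * q ^ k) q m *
              qPoch (a * d * q ^ k) q m /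
            (qPoch (a * y * q ^ k) q m * qPoch (a * b * c * d * q ^ (2 * k)) q m)) := by
  rw [add_assoc, Finset.sum_range_add, Finset.sum_eq_zero, zero_add, Finset.mul_sum]
  swap
  · intro j hj
    rw [awInvCoeff_eq_zero _ _ _ _ _ (Finset.mem_range.1 hj), mul_zero]
  refine Finset.sum_congr rfl fun m hm => ?_
  obtain ⟨l, rfl⟩ := Nat.exists_eq_add_of_le
    (show m ≤ n by have := Finset.mem_range.1 hm; omega)
  have e2 := qBinom_mul_qBinom h.q_pow k m l
  rw [add_assoc] at e2
  have h1 := qPoch_ne_zero' h.ab k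
  have h2 := qPoch_ne_zero' h.ac k
  have h3 := qPoch_ne_zero' hy.ad k
  have h1' := qPoch_ne_zero' (mul_pow_ne_one h.ab k) m
  have h2' := qPoch_ne_zero' (mul_pow_ne_one h.ac k) m
  have h3' := qPoch_ne_zero' (mul_pow_ne_one hy.ad k) m
  rw [awCoeff, awCoeff, awInvCoeff, Nat.add_sub_cancel_left, pow_qVandermonde h.q_ne_zero,
    qPoch_add (a * b) q k m, qPoch_add (a * c) q k m, qPoch_add (a * y) q k m,
    qPoch_add _ q k m]
  generalize (-1 : K) ^ k * q ^ (k.choose 2 + k) / q ^ ((k + (m + l)) * k) = s1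
  generalize (-1 : K) ^ m * q ^ (m.choose 2 + m) / q ^ ((m + l) * m) = s2
  generalize qPoch (a * b) q (k + (m + l)) * qPoch (a * c) q (k + (m + l)) *
    qPoch (a * y) q (k + (m + l)) / ((2 * a) ^ (k + (m + l)) *
      qPoch (a * b * c * y * q ^ (((k + (m + l) : ℕ) : ℤ) - 1)) q (k + (m + l))) = s3
  generalize (-1 : K) ^ k * (2 * a) ^ k * q ^ k.choose 2 = s4
  have h4 := qPoch_ne_zero' (mul_pow_ne_one h.abcd (2 * k)) m
  generalize qPoch (a * b * c * d * q ^ (2 * k)) q m = t at h4 ⊢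
  generalize qPoch (a * b) q k = x1 at h1 ⊢
  generalize qPoch (a * c) q k = x2 at h2 ⊢
  generalize qPoch (a * y) q k = x3 at h3 ⊢
  generalize qPoch (a * b * q ^ k) q m = y1 at h1' ⊢
  generalize qPoch (a * c * q ^ k) q m = y2 at h2' ⊢
  generalize qPoch (a * y * q ^ k) q m = y3 at h3' ⊢
  generalize qPoch (a * d * q ^ k) q m = y4
  generalize qPoch (a * b * c * y * q ^ (((k + (m + l) : ℕ) : ℤ) - 1)) q k = z1
  generalize qPoch (a * b * c * y * q ^ (((k + (m + l) : ℕ) : ℤ) - 1) * q ^ k) q m = z2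
  calc _ = qBinom q (k + (m + l)) (k + m) * qBinom q (k + m) k *
        (s1 * s2 * s3 * s4 * z1 * z2 * y4 / (x1 * x2 * x3 * y3 * t)) := by field_simp
    _ = _ := by
      rw [e2]
      field_simp

theorem sum_awCoeff_mul_awInvCoeff {a b c d q : K} (h : IsGeneric a b c d q) (n k : ℕ) :
    ∑ j ∈ Finset.range (n + 1), awCoeff a b c d q n j * awInvCoeff a b c d q j k =
      if n = k then 1 else 0 := by
  rcases lt_or_ge n k with hnk | hnk
  · rw [if_neg hnk.ne, Finset.sum_eq_zero]
    intro j hj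
    rw [awInvCoeff_eq_zero _ _ _ _ _ (by have := Finset.mem_range.1 hj; omega), mul_zero]
  obtain ⟨n, rfl⟩ := Nat.exists_eq_add_of_le hnk
  have hD : ∀ m, a * b * c * d * q ^ (2 * k) * q ^ m ≠ 1 := mul_pow_ne_one h.abcd _
  have e : ∀ m, qPoch (a * b * c * d * q ^ (((k + n : ℕ) : ℤ) - 1) * q ^ k) q m *
      qPoch (a * d * q ^ k) q m /
        (qPoch (a * d * q ^ k) q m * qPoch (a * b * c * d * q ^ (2 * k)) q m) =
      qPoch (a * b * c * d * q ^ (((k + n : ℕ) : ℤ) - 1) * q ^ k) q m /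
        qPoch (a * b * c * d * q ^ (2 * k)) q m := by
    intro m
    have := qPoch_ne_zero' (mul_pow_ne_one h.ad k) m
    field_simp
  rw [sum_awCoeff_mul h h]
  simp only [e]
  rw [qVandermonde h.q_ne_zero n _ _ hD]
  cases n with
  | zero =>
    have h1 := h.qPoch_abcd_ne_zero k
    have h2 := qPoch_ne_zero' h.ab k
    have h3 := qPoch_ne_zero' h.ac k
    have h4 := qPoch_ne_zero' h.ad k
    have h5 := pow_ne_zero k (mul_ne_zero h.two_ne_zero h.a_ne_zero)
    have h6 : q ^ (k * k) = q ^ (k.choose 2 + k) * q ^ k.choose 2 := by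
      rw [← pow_add, choose_two_add_self]
    have h7 : ((-1 : K) ^ k) * (-1) ^ k = 1 := by rw [← mul_pow]; simp
    have h8 := h.q_ne_zero
    simp only [add_zero, awCoeff, qBinom_self, Finset.range_zero, Finset.prod_empty, if_true]
    rw [h6]
    have h9 : ∀ x : K, qPoch x q 0 = 1 := fun x => by simp [qPoch]
    rw [h9, div_one, mul_one]
    generalize qPoch (a * b * c * d * q ^ ((k : ℤ) - 1)) q k = t at h1 ⊢
    generalize (2 * a) ^ k = s at h5 ⊢
    field_simp
    linear_combination h7
  | succ n =>
    -- Off the diagonal, the last factor of the product in `qVandermonde` is zero.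
    rw [if_neg (by omega), Finset.prod_range_succ]
    have : a * b * c * d * q ^ (((k + (n + 1) : ℕ) : ℤ) - 1) * q ^ k =
        a * b * c * d * q ^ (2 * k) * q ^ n := by
      have e : ((k + (n + 1) : ℕ) : ℤ) - 1 = ((k + n : ℕ) : ℤ) := by push_cast; ring
      rw [e, zpow_natCast]
      ring
    rw [this]
    simp

theorem awFactor_eq_sum {a b c d q : K} (h : IsGeneric a b c d q) (n : ℕ) :
    awFactor a q n = ∑ k ∈ Finset.range (n + 1),
      Polynomial.C (awInvCoeff a b c d q n k) * askeyWilson a b c d q k := by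
  set A : Matrix (Fin (n + 1)) (Fin (n + 1)) K := Matrix.of fun i j => awCoeff a b c d q i j
  set B : Matrix (Fin (n + 1)) (Fin (n + 1)) K := Matrix.of fun i j => awInvCoeff a b c d q i j
  have hext : ∀ (m : ℕ), m ≤ n → ∀ f : ℕ → K[X], (∀ j, m < j → f j = 0) →
      ∑ j ∈ Finset.range (m + 1), f j = ∑ j : Fin (n + 1), f j := by
    intro m hm f hf
    rw [← Fin.sum_univ_eq_sum_range, Fin.sum_univ_eq_sum_range f, Fin.sum_univ_eq_sum_range f]
    refine Finset.sum_subset (fun j hj => ?_) fun j _ hj => hf j (by simpa using hj)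
    have := Finset.mem_range.1 hj
    exact Finset.mem_range.2 (by omega)
  have hAB : A * B = 1 := by
    ext i k
    rw [Matrix.mul_apply, Matrix.one_apply]
    simp only [A, B, Matrix.of_apply]
    rw [Fin.sum_univ_eq_sum_range fun j => awCoeff a b c d q i j * awInvCoeff a b c d q j k,
      ← Finset.sum_subset (s₁ := Finset.range (i + 1)), sum_awCoeff_mul_awInvCoeff h]
    · simp [Fin.ext_iff]
    · intro j hj
      have := Finset.mem_range.1 hj
      have := i.2
      exact Finset.mem_range.2 (by omega)
    · intro j _ hj
      rw [awCoeff_eq_zero _ _ _ _ _ (by simpa using hj), zero_mul]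
  -- The `q`-sum gives the product in one order while the expansion needs the other; for the
  -- truncated square matrices a one-sided inverse is two-sided.
  have hBA : B * A = 1 := mul_eq_one_comm.1 hAB
  rw [hext n le_rfl _ fun j hj => by rw [awInvCoeff_eq_zero _ _ _ _ _ hj]; simp]
  have hp : ∀ k : Fin (n + 1), askeyWilson a b c d q k =
      ∑ j : Fin (n + 1), Polynomial.C (A k j) * awFactor a q j := by
    intro k
    rw [askeyWilson_eq_sum h, hext k (by omega) _ fun j hj => by
      rw [awCoeff_eq_zero _ _ _ _ _ hj]; simp]
    rfl
  simp only [hp, Finset.mul_sum, ← mul_assoc, ← Polynomial.C_mul]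
  rw [Finset.sum_comm]
  simp only [← Finset.sum_mul, ← map_sum]
  have : ∀ j, ∑ i : Fin (n + 1), awInvCoeff a b c d q n i * A i j =
      if Fin.last n = j then 1 else 0 := by
    intro j
    rw [← Matrix.one_apply, ← hBA, Matrix.mul_apply]
    rfl
  simp [this]

end Connection

/-! ### Connection coefficients when one parameter is switched on. -/

section Expansion

variable {K : Type*} [Field K]

theorem expansion_trans {P Q T : ℕ → K[X]} {A B : ℕ → ℕ → K} (hB : ∀ n k, n < k → B n k = 0)
    (hP : ∀ n, P n = ∑ k ∈ Finset.range (n + 1), Polynomial.C (A n k) * Q k)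
    (hQ : ∀ n, Q n = ∑ k ∈ Finset.range (n + 1), Polynomial.C (B n k) * T k) (n : ℕ) :
    P n = ∑ k ∈ Finset.range (n + 1), Polynomial.C (lmul A B n k) * T k := by
  simp only [lmul, map_sum, Finset.sum_mul]
  rw [Finset.sum_comm, hP]
  refine Finset.sum_congr rfl fun m hm => ?_
  rw [hQ, Finset.mul_sum]
  simp only [Polynomial.C_mul, mul_assoc]
  refine Finset.sum_subset ?_ ?_
  · intro k hk
    have h1 := Finset.mem_range.1 hk
    have h2 := Finset.mem_range.1 hm
    exact Finset.mem_range.2 (by omega)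
  · intro k _ hk
    rw [hB m k (by simpa using hk)]
    simp

/-- The connection coefficients between Askey–Wilson polynomials with parameters `a, b, c, 0`
and `a, b, c, d`. -/
def awConnection (a b c d q : K) (n k : ℕ) : K :=
  qBinom q n k * (d / 2) ^ (n - k) *
    (qPoch (a * b * q ^ k) q (n - k) * qPoch (a * c * q ^ k) q (n - k) *
      qPoch (b * c * q ^ k) q (n - k) / qPoch (a * b * c * d * q ^ (2 * k)) q (n - k))

theorem awConnection_eq_zero (a b c d q : K) {n k : ℕ} (h : n < k) :
    awConnection a b c d q n k = 0 := by
  rw [awConnection, qBinom_eq_zero q h]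
  simp

theorem sum_awCoeff_zero_mul_awInvCoeff {a b c d q : K} (h : IsGeneric a b c d q) (n k : ℕ) :
    ∑ j ∈ Finset.range (n + 1), awCoeff a b c 0 q n j * awInvCoeff a b c d q j k =
      awConnection a b c d q n k := by
  rcases lt_or_ge n k with hnk | hnk
  · rw [awConnection_eq_zero _ _ _ _ _ hnk, Finset.sum_eq_zero]
    intro j hj
    rw [awInvCoeff_eq_zero _ _ _ _ _ (by have := Finset.mem_range.1 hj; omega), mul_zero]
  obtain ⟨n, rfl⟩ := Nat.exists_eq_add_of_le hnk
  have hD : ∀ m, a * b * c * d * q ^ (2 * k) * q ^ m ≠ 1 := mul_pow_ne_one h.abcd _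
  -- Taking `a d q ^ k` out of each factor leaves `(b c q ^ k; q)_n`, which makes the result
  -- symmetric in `a, b, c`.
  have e : ∏ i ∈ Finset.range n, (a * d * q ^ k - a * b * c * d * q ^ (2 * k) * q ^ i) =
      (a * d * q ^ k) ^ n * qPoch (b * c * q ^ k) q n := by
    have e1 : (a * d * q ^ k) ^ n = ∏ _i ∈ Finset.range n, (a * d * q ^ k) := by simp
    rw [e1, qPoch, ← Finset.prod_mul_distrib]
    exact Finset.prod_congr rfl fun i _ => by ring
  rw [sum_awCoeff_mul h h.with_d_zero]
  simp only [mul_zero, zero_mul, qPoch_zero_left, one_mul]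
  rw [qVandermonde h.q_ne_zero n _ _ hD, e, awCoeff, awConnection, Nat.add_sub_cancel_left,
    qPoch_add (a * b), qPoch_add (a * c)]
  simp only [mul_zero, zero_mul, qPoch_zero_left, mul_one]
  have h1 := qPoch_ne_zero' h.ab k
  have h2 := qPoch_ne_zero' h.ac k
  have h3 := qPoch_ne_zero' hD n
  have h4 := h.q_ne_zero
  have h5 := h.two_ne_zero
  have h6 := h.a_ne_zero
  have h7 : ((-1 : K) ^ k) * (-1) ^ k = 1 := by rw [← mul_pow]; simp
  have h8 : q ^ ((k + n) * k) = q ^ (k.choose 2 + k) * q ^ k.choose 2 * q ^ (k * n) := by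
    rw [← pow_add, choose_two_add_self, ← pow_add]
    ring
  have h9 : (a * d * q ^ k) ^ n = a ^ n * d ^ n * q ^ (k * n) := by
    rw [mul_pow, mul_pow, ← pow_mul]
  have h10 : (2 * a) ^ (k + n) = (2 * a) ^ k * 2 ^ n * a ^ n := by rw [pow_add, mul_pow _ _ n]; ring
  rw [h8, h9, h10, div_pow]
  generalize (-1 : K) ^ k = s at h7 ⊢
  field_simp
  linear_combination (qPoch (a * b * q ^ k) q n * qPoch (a * q ^ k * c) q n *
    qBinom q (k + n) k * d ^ n * qPoch (b * q ^ k * c) q n) * h7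

theorem askeyWilson_d_zero {a b c d q : K} (h : IsGeneric a b c d q) (n : ℕ) :
    askeyWilson a b c 0 q n = ∑ k ∈ Finset.range (n + 1),
      Polynomial.C (awConnection a b c d q n k) * askeyWilson a b c d q k := by
  have e : awConnection a b c d q = lmul (awCoeff a b c 0 q) (awInvCoeff a b c d q) := by
    funext n k
    rw [← sum_awCoeff_zero_mul_awInvCoeff h]
    rfl
  rw [e]
  exact expansion_trans (fun n k => awInvCoeff_eq_zero a b c d q)
    (askeyWilson_eq_sum h.with_d_zero) (awFactor_eq_sum h) n

/-- Only the last parameter can be switched on by `askeyWilson_d_zero`. The evident symmetry in `b,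
c, d` brings `b` and `c` to that position; the deeper symmetry involving `a` is never needed. -/
theorem askeyWilson_swap (a b c d q : K) (n : ℕ) :
    askeyWilson a b c d q n = askeyWilson a b d c q n := by
  have e : a * b * c * d = a * b * d * c := by ring
  simp only [askeyWilson, e]
  have e2 : ∀ k, qPoch (a * b) q k * qPoch (a * c) q k * qPoch (a * d) q k =
      qPoch (a * b) q k * qPoch (a * d) q k * qPoch (a * c) q k := fun k => by ring
  simp only [e2]

theorem askeyWilson_rotate (a b c d q : K) (n : ℕ) :
    askeyWilson a b c d q n = askeyWilson a c d b q n := by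
  have e : a * b * c * d = a * c * d * b := by ring
  simp only [askeyWilson, e]
  have e2 : ∀ k, qPoch (a * b) q k * qPoch (a * c) q k * qPoch (a * d) q k =
      qPoch (a * c) q k * qPoch (a * d) q k * qPoch (a * b) q k := fun k => by ring
  simp only [e2]

/-! ### From `q`-Hermite to big `q`-Hermite polynomials, where division by `a` precludes
specializing `a = 0`. -/

/-- The continuous `q`-Hermite polynomials, rescaled to have the leading coefficient `2 ^ n`. -/
def qHermiteAux (q : K) (n : ℕ) : K[X] :=
  ∑ k ∈ Finset.range (n + 1),
    Polynomial.C (qBinom q n k) * Polynomial.Chebyshev.T K ((n : ℤ) - 2 * (k : ℤ))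

theorem qHermite_eq {q : K} (hq : ∀ m : ℕ, q ^ (m + 1) ≠ 1) (n : ℕ) :
    qHermite q n = Polynomial.C ((2 ^ n)⁻¹) * qHermiteAux q n := by
  rw [qHermite, qHermiteAux]
  congr 1
  refine Finset.sum_congr rfl fun k hk => ?_
  rw [qBinom_eq_div hq (by have := Finset.mem_range.1 hk; omega)]

/-- From `2 X T_m = T_{m+1} + T_{m-1}`, comparison of coefficients reduces to Pascal's rule and
`one_sub_mul_qBinom`. -/
theorem qHermiteAux_succ_succ {q : K} (hq : ∀ m : ℕ, q ^ (m + 1) ≠ 1) (n : ℕ) :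
    qHermiteAux q (n + 2) = 2 * Polynomial.X * qHermiteAux q (n + 1) -
      Polynomial.C (1 - q ^ (n + 1)) * qHermiteAux q n := by
  have hT : ∀ m : ℤ, 2 * Polynomial.X * Polynomial.Chebyshev.T K m =
      Polynomial.Chebyshev.T K (m + 1) + Polynomial.Chebyshev.T K (m - 1) := fun m => by
    rw [Polynomial.Chebyshev.T_sub_one]; ring
  set f : ℕ → K[X] := fun k => Polynomial.Chebyshev.T K (((n + 2 : ℕ) : ℤ) - 2 * (k : ℤ)) with hf
  have e1 : 2 * Polynomial.X * qHermiteAux q (n + 1) =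
      ∑ k ∈ Finset.range (n + 2), Polynomial.C (qBinom q (n + 1) k) * (f k + f (k + 1)) := by
    rw [qHermiteAux, Finset.mul_sum]
    refine Finset.sum_congr rfl fun k _ => ?_
    rw [mul_left_comm, hT]
    simp only [hf]
    congr 3
    · push_cast; ring
    · push_cast; ring
  have e2 : qHermiteAux q n = ∑ k ∈ Finset.range (n + 1), Polynomial.C (qBinom q n k) * f (k + 1) := by
    refine Finset.sum_congr rfl fun k _ => ?_
    simp only [hf]
    congr 2
    push_cast; ring
  have e3 : ∑ k ∈ Finset.range (n + 2), Polynomial.C (qBinom q (n + 1) k) * f k =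
      f 0 + ∑ k ∈ Finset.range (n + 2), Polynomial.C (qBinom q (n + 1) (k + 1)) * f (k + 1) := by
    rw [Finset.sum_range_succ', Finset.sum_range_succ (n := n + 1),
      qBinom_eq_zero q (Nat.lt_succ_self (n + 1))]
    simp [add_comm]
  have e4 : ∑ k ∈ Finset.range (n + 1), Polynomial.C (qBinom q n k) * f (k + 1) =
      ∑ k ∈ Finset.range (n + 2), Polynomial.C (qBinom q n k) * f (k + 1) := by
    rw [Finset.sum_range_succ (n := n + 1), qBinom_eq_zero q (Nat.lt_succ_self n)]
    simp
  rw [e1, e2, e4]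
  simp only [mul_add, Finset.sum_add_distrib]
  rw [e3, qHermiteAux, Finset.sum_range_succ', qBinom_zero_right, Polynomial.C_1, one_mul,
    Finset.mul_sum, add_assoc, ← Finset.sum_add_distrib, add_sub_assoc, ← Finset.sum_sub_distrib,
    add_comm]
  congr 1
  refine Finset.sum_congr rfl fun k _ => ?_
  have h := congrArg Polynomial.C (one_sub_mul_qBinom hq n k)
  rw [qBinom_succ_succ q (n + 1)]
  simp only [Polynomial.C_mul, Polynomial.C_add] at h ⊢
  simp only [Polynomial.C_sub, Polynomial.C_1] at h ⊢
  linear_combination (-f (k + 1)) * h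

/-- The continuous big `q`-Hermite polynomials, rescaled to have the leading coefficient
`2 ^ n`. -/
def bigHermiteAux (a q : K) (n : ℕ) : K[X] :=
  Polynomial.C (2 ^ n) * askeyWilson a 0 0 0 q n

theorem bigHermiteAux_eq_sum {a q : K} (h : IsGeneric a 0 0 0 q) (n : ℕ) :
    bigHermiteAux a q n = ∑ j ∈ Finset.range (n + 1),
      Polynomial.C ((a ^ n)⁻¹ *
        (qBinom q n j * ((-1) ^ j * q ^ (j.choose 2 + j) / q ^ (n * j)))) * awFactor a q j := by
  rw [bigHermiteAux, askeyWilson_eq_sum h, Finset.mul_sum]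
  refine Finset.sum_congr rfl fun j _ => ?_
  rw [← mul_assoc, ← Polynomial.C_mul]
  congr 2
  have h2 := h.two_ne_zero
  simp only [awCoeff, mul_zero, zero_mul, qPoch_zero_left, mul_one, div_one, mul_pow]
  field_simp

theorem one_sub_mul_qBinom' {q : K} (hq : ∀ m : ℕ, q ^ (m + 1) ≠ 1) (m j : ℕ) :
    (1 - q ^ (m + 1)) * qBinom q (j + m + 1) j = (1 - q ^ (j + m + 1)) * qBinom q (j + m) j := by
  rw [qBinom_eq_div hq (by omega), qBinom_eq_div hq (by omega),
    show j + m + 1 - j = m + 1 by omega, Nat.add_sub_cancel_left, qPoch_succ, qPoch_succ]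
  have h1 := qPoch_self_ne_zero hq j
  have h2 := qPoch_self_ne_zero hq m
  have h3 : 1 - q * q ^ m ≠ 0 := sub_ne_zero.2 (by rw [← pow_succ']; exact (hq m).symm)
  field_simp
  ring

/-- Multiplication by `2 X` is bidiagonal in the basis `awFactor a q j` (`hX`). By `hA` the
lower-order terms of the recurrence merge into a telescoping shape (`hR`), and the resulting
coefficient identity `hC` is Pascal's rule. -/
theorem bigHermiteAux_succ_succ {a q : K} (h : IsGeneric a 0 0 0 q) (n : ℕ) :
    bigHermiteAux a q (n + 2) = 2 * Polynomial.X * bigHermiteAux a q (n + 1) -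
      Polynomial.C (a * q ^ (n + 1)) * bigHermiteAux a q (n + 1) -
      Polynomial.C (1 - q ^ (n + 1)) * bigHermiteAux a q n := by
  have ha := h.a_ne_zero
  have hq0 := h.q_ne_zero
  set b : ℕ → ℕ → K := fun n j => (a ^ n)⁻¹ *
    (qBinom q n j * ((-1) ^ j * q ^ (j.choose 2 + j) / q ^ (n * j))) with hb
  have hb0 : ∀ n j, n < j → b n j = 0 := fun n j hj => by
    simp only [hb, qBinom_eq_zero q hj]; simp
  have hB : ∀ m, m < n + 3 → bigHermiteAux a q m =
      ∑ j ∈ Finset.range (n + 3), Polynomial.C (b m j) * awFactor a q j := by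
    intro m hm
    rw [bigHermiteAux_eq_sum h]
    refine Finset.sum_subset (fun j hj => ?_) fun j _ hj => ?_
    · have := Finset.mem_range.1 hj
      exact Finset.mem_range.2 (by omega)
    · change Polynomial.C (b m j) * _ = 0
      rw [hb0 m j (by simpa using hj), Polynomial.C_0, zero_mul]
  have hA : ∀ j, b (n + 1) j * (a * q ^ j) - a * q ^ (n + 1) * b (n + 1) j =
      (1 - q ^ (n + 1)) * b n j := by
    intro j
    rcases lt_trichotomy j (n + 1) with hj | rfl | hj
    · obtain ⟨m, rfl⟩ := Nat.exists_eq_add_of_le (Nat.le_of_lt_succ hj)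
      have e := one_sub_mul_qBinom' h.q_pow m j
      have e1 : q ^ ((j + m + 1) * j) = q ^ ((j + m) * j) * q ^ j := by ring
      have e2 : q ^ (j + m + 1) = q ^ j * q ^ (m + 1) := by ring
      simp only [hb, e1, pow_succ a]
      field_simp
      rw [e2] at e ⊢
      linear_combination q ^ j * e
    · rw [hb0 n _ (Nat.lt_succ_self n)]
      ring
    · rw [hb0 n j (by omega), hb0 (n + 1) j hj]
      ring
  have hC : ∀ j, j < n + 2 → b (n + 2) (j + 1) =
      b (n + 1) (j + 1) / (a * q ^ (j + 1)) - b (n + 1) j / (a * q ^ j) := by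
    intro j hj
    obtain ⟨m, hm⟩ := Nat.exists_eq_add_of_le (Nat.le_of_lt_succ hj)
    have e := qBinom_succ_succ' h.q_pow (Nat.le_of_lt_succ hj)
    have e0 : (j + 1).choose 2 = j + j.choose 2 := by
      rw [Nat.choose_succ_succ' j 1, Nat.choose_one_right]
    have e1 : q ^ ((n + 2) * (j + 1)) = q ^ ((n + 1) * j) * q ^ (n + 1) * q ^ j * q := by ring
    have e2 : q ^ ((n + 1) * (j + 1)) = q ^ ((n + 1) * j) * q ^ (n + 1) := by ring
    have e3 : q ^ (n + 1) = q ^ j * q ^ m := by rw [hm, pow_add]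
    have e4 : n + 1 - j = m := by omega
    simp only [hb, e, e0, e1, e2, pow_succ a (n + 1)]
    rw [e3, e4]
    field_simp
    ring
  have hX : ∀ j, 2 * Polynomial.X * awFactor a q j =
      Polynomial.C ((a * q ^ j)⁻¹ + a * q ^ j) * awFactor a q j -
        Polynomial.C ((a * q ^ j)⁻¹) * awFactor a q (j + 1) := by
    intro j
    rw [awFactor, awFactor, Finset.prod_range_succ]
    have e : Polynomial.C ((a * q ^ j)⁻¹) * Polynomial.C (a * q ^ j) = (1 : K[X]) := by
      rw [← Polynomial.C_mul, inv_mul_cancel₀ (mul_ne_zero ha (pow_ne_zero _ hq0)),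
        Polynomial.C_1]
    have e1 : Polynomial.C (2 * a * q ^ j) = 2 * Polynomial.C (a * q ^ j) := by
      rw [mul_assoc, Polynomial.C_mul]; rfl
    have e2 : Polynomial.C (a ^ 2 * q ^ (2 * j)) =
        Polynomial.C (a * q ^ j) * Polynomial.C (a * q ^ j) := by
      rw [← Polynomial.C_mul]; congr 1; ring
    rw [e1, e2, Polynomial.C_add]
    generalize ∏ j ∈ Finset.range j, (1 - Polynomial.C (2 * a * q ^ j) * Polynomial.X +
      Polynomial.C (a ^ 2 * q ^ (2 * j))) = p
    linear_combination (Polynomial.C (a * q ^ j) * p - 2 * Polynomial.X * p) * e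
  have hR : 2 * Polynomial.X * bigHermiteAux a q (n + 1) -
      Polynomial.C (a * q ^ (n + 1)) * bigHermiteAux a q (n + 1) -
      Polynomial.C (1 - q ^ (n + 1)) * bigHermiteAux a q n =
      ∑ j ∈ Finset.range (n + 3), Polynomial.C (b (n + 1) j / (a * q ^ j)) *
        (awFactor a q j - awFactor a q (j + 1)) := by
    rw [hB (n + 1) (by omega), hB n (by omega), Finset.mul_sum, Finset.mul_sum, Finset.mul_sum,
      ← Finset.sum_sub_distrib, ← Finset.sum_sub_distrib]
    refine Finset.sum_congr rfl fun j _ => ?_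
    have e := congrArg Polynomial.C (hA j)
    rw [mul_left_comm, hX, div_eq_mul_inv]
    simp only [Polynomial.C_sub, Polynomial.C_mul, Polynomial.C_add] at e ⊢
    linear_combination awFactor a q j * e
  rw [hR, hB (n + 2) (by omega), Finset.sum_range_succ']
  simp only [mul_sub, Finset.sum_sub_distrib]
  rw [Finset.sum_range_succ' _ (n + 2),
    Finset.sum_range_succ (fun j => Polynomial.C (b (n + 1) j / (a * q ^ j)) *
      awFactor a q (j + 1)) (n + 2), hb0 (n + 1) (n + 2) (by omega), add_sub_assoc, ]
  rw [Finset.sum_congr rfl fun j hj => by rw [hC j (Finset.mem_range.1 hj)]]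
  simp only [Polynomial.C_sub, sub_mul, Finset.sum_sub_distrib]
  have e : b (n + 2) 0 = b (n + 1) 0 / (a * q ^ 0) := by
    simp only [hb]
    simp [pow_succ]
    ring
  rw [e]
  simp only [zero_div, Polynomial.C_0, zero_mul, add_zero]
  ring

/-- For `n = 0` the truncated index `n - 1` is harmless, since its coefficient `1 - q ^ 0` vanishes.
-/
theorem two_mul_X_mul_bigHermiteAux {a q : K} (h : IsGeneric a 0 0 0 q) (n : ℕ) :
    2 * Polynomial.X * bigHermiteAux a q n = bigHermiteAux a q (n + 1) +
      Polynomial.C (a * q ^ n) * bigHermiteAux a q n +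
      Polynomial.C (1 - q ^ n) * bigHermiteAux a q (n - 1) := by
  cases n with
  | zero =>
    have ha := h.a_ne_zero
    have hq := h.q_ne_zero
    simp only [bigHermiteAux_eq_sum h, Finset.sum_range_succ, awFactor, qBinom]
    have e : Polynomial.C a⁻¹ * Polynomial.C a = (1 : K[X]) := by
      rw [← Polynomial.C_mul, inv_mul_cancel₀ ha, Polynomial.C_1]
    have e' : (Polynomial.C 2 : K[X]) = 2 := rfl
    simp only [zero_add, mul_zero, Finset.range_zero, Finset.sum_empty, Finset.prod_empty,
      Finset.range_one, Finset.prod_singleton]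
    simp [hq, e']
    linear_combination (Polynomial.C a - 2 * Polynomial.X) * e
  | succ n =>
    rw [bigHermiteAux_succ_succ h, Nat.add_sub_cancel]
    ring

/-- The transform `∑_k [n choose k]_q a^{n-k} B_k` of a sequence of polynomials. -/
def binomTransform (a q : K) (B : ℕ → K[X]) (n : ℕ) : K[X] :=
  ∑ k ∈ Finset.range (n + 1), Polynomial.C (qBinom q n k * a ^ (n - k)) * B k

theorem binomTransform_succ (a q : K) (B : ℕ → K[X]) (n : ℕ) :
    binomTransform a q B (n + 1) = ∑ k ∈ Finset.range (n + 1),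
      (Polynomial.C (qBinom q n k * a ^ (n - k)) * B (k + 1) +
        Polynomial.C (qBinom q n k * a ^ (n - k) * (a * q ^ k)) * B k) := by
  have e2 : ∑ k ∈ Finset.range (n + 1),
      Polynomial.C (qBinom q n k * a ^ (n - k) * (a * q ^ k)) * B k =
      ∑ k ∈ Finset.range (n + 1),
        Polynomial.C (q ^ (k + 1) * qBinom q n (k + 1) * a ^ (n - k)) * B (k + 1) +
      Polynomial.C (a ^ (n + 1)) * B 0 := by
    rw [Finset.sum_range_succ', Finset.sum_range_succ (n := n),
      qBinom_eq_zero q (Nat.lt_succ_self n), mul_zero, zero_mul, Polynomial.C_0, zero_mul, add_zero]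
    refine congrArg₂ (· + ·) (Finset.sum_congr rfl fun k hk => ?_) ?_
    · have e : n - k = n - (k + 1) + 1 := by have := Finset.mem_range.1 hk; omega
      rw [e, pow_succ a]
      refine congrArg (fun x => Polynomial.C x * B (k + 1)) ?_
      ring
    · refine congrArg (fun x => Polynomial.C x * B 0) ?_
      rw [qBinom_zero_right, Nat.sub_zero]
      ring
  rw [Finset.sum_add_distrib, e2, ← add_assoc, ← Finset.sum_add_distrib, binomTransform,
    Finset.sum_range_succ']
  refine congrArg₂ (· + ·) (Finset.sum_congr rfl fun k hk => ?_) ?_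
  · rw [← add_mul, ← Polynomial.C_add, qBinom_succ_succ, Nat.add_sub_add_right]
    refine congrArg (fun x => Polynomial.C x * B (k + 1)) ?_
    ring
  · rw [qBinom_zero_right, one_mul, Nat.sub_zero]

theorem binomTransform_pred {q : K} (hq : ∀ m : ℕ, q ^ (m + 1) ≠ 1) (a : K) (B : ℕ → K[X])
    (n : ℕ) :
    ∑ k ∈ Finset.range (n + 2),
      Polynomial.C (qBinom q (n + 1) k * a ^ (n + 1 - k) * (1 - q ^ k)) * B (k - 1) =
      Polynomial.C (1 - q ^ (n + 1)) * binomTransform a q B n := by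
  rw [Finset.sum_range_succ', binomTransform, Finset.mul_sum, pow_zero, sub_self, mul_zero,
    Polynomial.C_0, zero_mul, add_zero]
  refine Finset.sum_congr rfl fun k _ => ?_
  rw [← mul_assoc, ← Polynomial.C_mul, Nat.add_sub_add_right, Nat.add_sub_cancel]
  refine congrArg (fun x => Polynomial.C x * B k) ?_
  linear_combination a ^ (n - k) * one_sub_mul_qBinom hq n k

/-- The transform absorbs the diagonal term `a q ^ n` of the recurrence for `B`, leaving exactly the
recurrence of the `q`-Hermite polynomials. -/
theorem binomTransform_succ_succ {a q : K} (hq : ∀ m : ℕ, q ^ (m + 1) ≠ 1) {B : ℕ → K[X]}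
    (hB : ∀ n, 2 * Polynomial.X * B n = B (n + 1) + Polynomial.C (a * q ^ n) * B n +
      Polynomial.C (1 - q ^ n) * B (n - 1)) (n : ℕ) :
    binomTransform a q B (n + 2) = 2 * Polynomial.X * binomTransform a q B (n + 1) -
      Polynomial.C (1 - q ^ (n + 1)) * binomTransform a q B n := by
  rw [← binomTransform_pred hq, binomTransform_succ, binomTransform.eq_1 a q B (n + 1),
    Finset.mul_sum, ← Finset.sum_sub_distrib]
  refine Finset.sum_congr rfl fun k _ => ?_
  rw [Polynomial.C_mul (a := qBinom q (n + 1) k * _) (b := a * _),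
    Polynomial.C_mul (a := qBinom q (n + 1) k * _) (b := 1 - _)]
  linear_combination (-Polynomial.C (qBinom q (n + 1) k * a ^ (n + 1 - k))) * hB k

theorem qHermiteAux_eq_binomTransform {a q : K} (h : IsGeneric a 0 0 0 q) (n : ℕ) :
    qHermiteAux q n = binomTransform a q (bigHermiteAux a q) n := by
  have h0 : bigHermiteAux a q 0 = 1 := by
    simp [bigHermiteAux_eq_sum h, awFactor]
  induction n using Nat.twoStepInduction with
  | zero => simp [qHermiteAux, binomTransform, h0]
  | one =>
    have h1 := two_mul_X_mul_bigHermiteAux h 0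
    simp only [h0, zero_add, pow_zero, mul_one, sub_self, Polynomial.C_0, add_zero] at h1
    simp [qHermiteAux, binomTransform, h0, Finset.sum_range_succ]
    linear_combination h1
  | more n ih1 ih2 =>
    rw [qHermiteAux_succ_succ h.q_pow, binomTransform_succ_succ h.q_pow
      (two_mul_X_mul_bigHermiteAux h), ih1, ih2]

theorem qHermite_eq_sum {a q : K} (h : IsGeneric a 0 0 0 q) (n : ℕ) :
    qHermite q n = ∑ k ∈ Finset.range (n + 1),
      Polynomial.C (qBinom q n k * (a / 2) ^ (n - k)) * askeyWilson a 0 0 0 q k := by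
  rw [qHermite_eq h.q_pow, qHermiteAux_eq_binomTransform h, binomTransform, Finset.mul_sum]
  refine Finset.sum_congr rfl fun k hk => ?_
  rw [bigHermiteAux, ← mul_assoc, ← mul_assoc, ← Polynomial.C_mul, ← Polynomial.C_mul]
  congr 2
  obtain ⟨m, rfl⟩ := Nat.exists_eq_add_of_le (Nat.le_of_lt_succ (Finset.mem_range.1 hk))
  have h2 := h.two_ne_zero
  rw [Nat.add_sub_cancel_left, div_pow, pow_add]
  field_simp

end Expansion

/-! ### Factorization and positivity of the moment matrix. -/

section Moments

variable {K : Type*} [Field K]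

/-- The chain of parameters is `(a,0,0,0)`, `(a,b,0,0)`, `(a,b,c,0)`, `(a,b,c,d)`; uniqueness of the
expansion identifies the product with the moments. -/
theorem sigmaAWH_eq {a b c d q : K} (h : IsGeneric a b c d q) :
    sigmaAWH h = lmul (lmul (lmul (fun n k => qBinom q n k * (a / 2) ^ (n - k))
      (awConnection a 0 0 b q)) (awConnection a b 0 c q)) (awConnection a b c d q) := by
  have h1 : IsGeneric a b 0 c q :=
    { h with
      ac := by simp
      ad := h.ac
      abcd := by simp }
  have h2 : IsGeneric a 0 0 b q :=
    { h with
      ab := by simp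
      ac := by simp
      ad := h.ab
      abcd := by simp }
  have h3 : IsGeneric a 0 0 0 q := h2.with_d_zero
  have z : ∀ a b c d : K, ∀ n k, n < k → awConnection a b c d q n k = 0 :=
    fun a b c d n k => awConnection_eq_zero a b c d q
  refine ((eq_sigmaAWH_iff h _).2 ⟨fun n k hnk => lmul_eq_zero (z _ _ _ _) hnk, ?_⟩).symm
  refine expansion_trans (z _ _ _ _) ?_ (askeyWilson_d_zero h)
  refine expansion_trans (Q := askeyWilson a b 0 0 q) (z _ _ _ _) ?_ fun n => ?_
  · refine expansion_trans (z _ _ _ _) (qHermite_eq_sum h3) fun n => ?_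
    have e : ∀ k, askeyWilson a b 0 0 q k = askeyWilson a 0 0 b q k :=
      askeyWilson_rotate a b 0 0 q
    simp only [e]
    exact askeyWilson_d_zero h2 n
  · have e : ∀ k, askeyWilson a b c 0 q k = askeyWilson a b 0 c q k := askeyWilson_swap a b c 0 q
    simp only [e]
    exact askeyWilson_d_zero h1 n

/-- The matrix `gMat` for the rescaled connection coefficients of Askey–Wilson polynomials. -/
def rescaledConnection {R : Type*} [CommRing R] [Inv R] (a b c d q : R) : ℕ → ℕ → R :=
  gMat q (a * b) (c * d) fun i => d * (1 + a * c * q ^ i) * (1 + b * c * q ^ i)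

theorem rescaledConnection_eq_zero {R : Type*} [CommRing R] [Inv R] (a b c d q : R) (n k : ℕ)
    (h : n < k) : rescaledConnection a b c d q n k = 0 :=
  gMat_eq_zero _ _ _ _ h

theorem prod_Ico_eq_qPoch (x q : K) (k n : ℕ) :
    ∏ i ∈ Finset.Ico k (k + n), (1 + x * q ^ i) = qPoch (-(x * q ^ k)) q n := by
  rw [Finset.prod_Ico_eq_prod_range, Nat.add_sub_cancel_left, qPoch]
  exact Finset.prod_congr rfl fun i _ => by rw [pow_add]; ring

/-- The symbols in `a c` and `b c` are products over `k ≤ i < n` and so enter the weights `β_i`. The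
symbol in `a b` goes with the one in `a b c d`, whose base `q ^ (2 k)` prevents such a splitting,
into the quotient of `gMat`. -/
theorem zpow_mul_awConnection {i : K} (hi : i * i = -1) (h2 : (2 : K) ≠ 0) (a b c d q : K)
    (n k : ℕ) :
    (2 / i) ^ ((n : ℤ) - (k : ℤ)) * awConnection (i * a) (i * b) (i * c) (i * d) q n k =
      rescaledConnection a b c d q n k := by
  rcases lt_or_ge n k with h | h
  · rw [awConnection_eq_zero _ _ _ _ _ h, rescaledConnection_eq_zero _ _ _ _ _ _ _ h, mul_zero]
  obtain ⟨n, rfl⟩ := Nat.exists_eq_add_of_le h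
  have hi0 : i ≠ 0 := by rintro rfl; simp at hi
  have e : ∀ x y : K, i * x * (i * y) = -(x * y) := fun x y => by
    linear_combination x * y * hi
  have e4 : i * a * (i * b) * (i * c) * (i * d) = a * b * (c * d) := by
    rw [e, mul_assoc, e]; ring
  have e5 : (2 / i) ^ (((k + n : ℕ) : ℤ) - (k : ℤ)) * (i * d / 2) ^ n = d ^ n := by
    rw [Nat.cast_add, add_sub_cancel_left, zpow_natCast, ← mul_pow]
    congr 1
    field_simp
  rw [rescaledConnection, gMat_eq_div, wMat, Finset.prod_mul_distrib, Finset.prod_mul_distrib,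
    prod_Ico_eq_qPoch, prod_Ico_eq_qPoch, awConnection, e4, e, e, e, Nat.add_sub_cancel_left,
    Finset.prod_const, Nat.card_Ico, Nat.add_sub_cancel_left, ← e5]
  simp only [neg_mul]
  ring

/-- The rescaling is conjugation by the diagonal matrix with entries `t ^ n`, hence multiplicative.
-/
theorem zpow_mul_lmul {t : K} (ht : t ≠ 0) (A B : ℕ → ℕ → K) (n k : ℕ) :
    t ^ ((n : ℤ) - (k : ℤ)) * lmul A B n k =
      lmul (fun n k => t ^ ((n : ℤ) - (k : ℤ)) * A n k)
        (fun n k => t ^ ((n : ℤ) - (k : ℤ)) * B n k) n k := by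
  rw [lmul, lmul, Finset.mul_sum]
  refine Finset.sum_congr rfl fun m _ => ?_
  rw [← sub_add_sub_cancel (n : ℤ) (m : ℤ) (k : ℤ), zpow_add₀ ht]
  ring

theorem zpow_mul_qBinom {i : K} (hi : i * i = -1) (h2 : (2 : K) ≠ 0) (a q : K) (n k : ℕ) :
    (2 / i) ^ ((n : ℤ) - (k : ℤ)) * (qBinom q n k * (i * a / 2) ^ (n - k)) =
      wMat q (fun _ => a) n k := by
  rcases lt_or_ge n k with h | h
  · rw [wMat_eq_zero _ _ h, qBinom_eq_zero q h, zero_mul, mul_zero]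
  obtain ⟨n, rfl⟩ := Nat.exists_eq_add_of_le h
  have hi0 : i ≠ 0 := by rintro rfl; simp at hi
  rw [wMat, Finset.prod_const, Nat.card_Ico, Nat.add_sub_cancel_left, Nat.cast_add,
    add_sub_cancel_left, zpow_natCast, mul_left_comm, ← mul_pow]
  congr 2
  field_simp

theorem algebraMap_rescaledConnection (a b c d q : PS)
    (h : MvPowerSeries.constantCoeff a = 0) (n k : ℕ) :
    algebraMap PS PSField (rescaledConnection a b c d q n k) =
      rescaledConnection (algebraMap PS PSField a) (algebraMap PS PSField b)
        (algebraMap PS PSField c) (algebraMap PS PSField d) (algebraMap PS PSField q) n k := by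
  rw [rescaledConnection, algebraMap_gMat (by simp [h])]
  simp [rescaledConnection]

/-- The rescaled mixed moments as power series. -/
def momentSeries : ℕ → ℕ → PS :=
  lmul (lmul (lmul (wMat (MvPowerSeries.X 4) fun _ => MvPowerSeries.X 0)
    (rescaledConnection (MvPowerSeries.X 0) 0 0 (MvPowerSeries.X 1) (MvPowerSeries.X 4)))
    (rescaledConnection (MvPowerSeries.X 0) (MvPowerSeries.X 1) 0 (MvPowerSeries.X 2)
      (MvPowerSeries.X 4)))
    (rescaledConnection (MvPowerSeries.X 0) (MvPowerSeries.X 1) (MvPowerSeries.X 2)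
      (MvPowerSeries.X 3) (MvPowerSeries.X 4))

theorem rescaledMoment_eq (n k : ℕ) :
    rescaledMoment n k = algebraMap PS PSField (momentSeries n k) := by
  have h2 := isGeneric.two_ne_zero
  have hi0 : im ≠ 0 := fun h => by simpa [h] using im_mul_im
  have hc := zpow_mul_awConnection im_mul_im h2
  have hc2 := hc (var 0) 0 0 (var 1) (var 4)
  have hc3 := hc (var 0) (var 1) 0 (var 2) (var 4)
  simp only [mul_zero] at hc2 hc3
  have hX : MvPowerSeries.constantCoeff (MvPowerSeries.X 0 : PS) = 0 := by simp
  have ht : 2 / im ≠ 0 := div_ne_zero h2 hi0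
  rw [rescaledMoment, sigmaAWH_eq, zpow_mul_lmul ht]
  simp only [zpow_mul_lmul ht, hc, hc2, hc3, zpow_mul_qBinom im_mul_im h2]
  rw [momentSeries, algebraMap_lmul]
  simp only [algebraMap_lmul, algebraMap_rescaledConnection _ _ _ _ _ hX, algebraMap_wMat,
    map_zero]
  rfl

/-- Here `u = a b` always contains the variable `a`, so all three products converge `X 0`-adically,
including when `b` is zero. -/
theorem IsTotallyPositive.lmul_rescaledConnection {M : ℕ → ℕ → PS}
    (hM : IsTotallyPositive natSeries M) (hL : ∀ n k, n < k → M n k = 0) {b c d : PS}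
    (hb : b ∈ natSeries) (hc : c ∈ natSeries) (hd : d ∈ natSeries) :
    IsTotallyPositive natSeries
      (lmul M (rescaledConnection (MvPowerSeries.X 0) b c d (MvPowerSeries.X 4))) := by
  have h0 := X_mem_natSeries 0
  have h4 := X_mem_natSeries 4
  refine isTotallyPositive_lmul_gMat 0 (by simp) h4 (natSeries.mul_mem h0 hb)
    (natSeries.mul_mem hc hd) (dvd_mul_right _ _) (fun i => ?_) hM hL
  have e : ∀ x y : PS, x ∈ natSeries → y ∈ natSeries →
      1 + x * y * MvPowerSeries.X 4 ^ i ∈ natSeries := fun x y hx hy =>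
    natSeries.add_mem natSeries.one_mem
      (natSeries.mul_mem (natSeries.mul_mem hx hy) (natSeries.pow_mem h4 _))
  exact natSeries.mul_mem (natSeries.mul_mem hd (e _ _ h0 hc)) (e _ _ hb hc)

theorem isTotallyPositive_momentSeries : IsTotallyPositive natSeries momentSeries := by
  have h := X_mem_natSeries
  have z : ∀ b c d : PS, ∀ M : ℕ → ℕ → PS, ∀ n k, n < k →
      lmul M (rescaledConnection (MvPowerSeries.X 0) b c d (MvPowerSeries.X 4)) n k = 0 :=
    fun b c d M n k hnk => lmul_eq_zero (rescaledConnection_eq_zero _ _ _ _ _) hnk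
  have h1 : IsTotallyPositive natSeries
      (wMat (MvPowerSeries.X 4 : PS) fun _ => MvPowerSeries.X 0) := by
    rw [← one_lmul (wMat _ _)]
    exact (isTotallyPositive_one natSeries).lmul_wMat (fun n k hnk => if_neg hnk.ne) (h 4)
      fun _ => h 0
  exact ((h1.lmul_rescaledConnection (fun n k => wMat_eq_zero _ _) natSeries.zero_mem
    natSeries.zero_mem (h 1)).lmul_rescaledConnection (z _ _ _ _) (h 1) natSeries.zero_mem
      (h 2)).lmul_rescaledConnection (z _ _ _ _) (h 1) (h 2) (h 3)

end Moments

end AskeyWilson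
end

theorem mainTheorem10 (r : ℕ) (rows cols : Fin r → ℕ)
    (hrows : StrictMono rows) (hcols : StrictMono cols) :
    AskeyWilson.IsNonnegIntPowerSeries
      (Matrix.det (Matrix.of fun i j : Fin r =>
        AskeyWilson.rescaledMoment (rows i) (cols j))) := by
  obtain ⟨f, hf⟩ := AskeyWilson.isTotallyPositive_momentSeries r rows cols hrows hcols
  refine ⟨f, ?_⟩
  rw [hf, RingHom.map_det]
  congr 1
  ext i j
  exact AskeyWilson.rescaledMoment_eq (rows i) (cols j)
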